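/- Let $N\ge 2$ be even, let $\tau\in\mathbb C$ with $\operatorname{Im}\tau>0$, $q=e^{i\pi\tau}$, $\theta_3=1+2\sum_{n\ge1}q^{n^2}$, $\theta_4=1+2\sum_{n\ge1}(-1)^nq^{n^2}$, and suppose that $J_x=\theta_3/\theta_4$ and $J_y=\theta_4/\theta_3$ are real and positive (as is the case when $\tau$ is purely imaginary). On $(\mathbb C^2)^{\otimes N}$, let $$H_{XY}=\sum_{n=1}^N\bigl(J_x\sigma^x_n\sigma^x_{n+1}+J_y\sigma^y_n\sigma^y_{n+1}\bigr),\qquad \sigma^\alpha_{N+1}=\sigma^\alpha_1 ,$$ be the Hamiltonian of the periodic XY spin chain, where $\sigma_n^\alpha$ is the Pauli matrix $\sigma^\alpha$ acting on the $n$th factor. For $u\in\mathbb Z$ put $\psi(u)=\frac1{\sqrt2}\binom{1}{i^u}$. For $\kappa=\pm1$ and $\mathbf n=(n_1,\dots,n_M)$ with $1\le n_1<\dots<n_M\le N$ let $$|\kappa;\mathbf n\rangle=(-i)^{n_1+\dots+n_M}\bigotimes_{l=1}^N\psi\bigl(l-2\,\#\{j:n_j<l\}-\kappa\bigr).$$ Let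 $\varphi(p)=\frac12\arctan\bigl(\frac{J_x-J_y}{J_x+J_y}\tan p\bigr)$ if $\cos p\ne0$, and let $\varphi(p)$ be the limit from the left of this function if $\cos p=0$ (that is, $\frac\pi4$ if $J_x>J_y$ and $-\frac\pi4$ if $J_x<J_y$). Call $M\in\{0,1,\dots,N\}$ admissible if $M\equiv N/2 \pmod 2$. For every admissible $M$, every $\xi\in\{0,1\}$ and all quasi-momenta $-\frac\pi2<p_1<\dots<p_M\le\frac{3\pi}2$ with $e^{iNp_j}=(-1)^{\xi+1}$ for all $j$, put $$|\widetilde\Psi_M(\mathbf p)\rangle=\sum_{1\le n_1<\dots<n_M\le N}\ \sum_{\kappa=\pm1}\widetilde\chi_{\mathbf n}(\mathbf p)\,\kappa^\xi\,|\kappa;\mathbf n\rangle,\qquad \widetilde\chi_{\mathbf n}(\mathbf p)=\frac1{\sqrt{2N^M}}\det_{j,l=1,\dots,M}\Bigl(\exp\bigl[i\bigl(n_jp_l-(-1)^{n_j}\varphi(p_l)\bigr)\bigr]\Bigr).$$ Then these states, over all such $M$, $\xi$ and $\mathbf p$, form an orthonormal basis of $(\mathbb C^2)^{\otimes N}$,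 and each of them is an eigenvector of $H_{XY}$: $$H_{XY}|\widetilde\Psi_M(\mathbf p)\rangle=\Bigl(\sum_{j=1}^M\pm2\sqrt{4\cos^2p_j+(J_x-J_y)^2}\Bigr)|\widetilde\Psi_M(\mathbf p)\rangle,$$ where the sign is $+$ for $p_j\in(-\frac\pi2,\frac\pi2]$ and $-$ for $p_j\in(\frac\pi2,\frac{3\pi}2]$. -/

import Mathlib

noncomputable section

namespace ChiralXY

/-- The space of states `(ℂ²)^{⊗N}` of `N` spins one half. The coordinate of a vector at
`s : Fin N → Fin 2` is its coefficient at the product vector `e_{s 0} ⊗ ⋯ ⊗ e_{s (N-1)}` of the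
standard basis `e₀ = (1, 0)`, `e₁ = (0, 1)` of `ℂ²`; the inner product is the standard one.
Site `n = 1, …, N` of the chain is the element `n - 1` of `Fin N`. -/
abbrev StateSpace (N : ℕ) : Type := EuclideanSpace ℂ (Fin N → Fin 2)

/-- The Pauli matrix `σ^x`. -/
def pauliX : Matrix (Fin 2) (Fin 2) ℂ := !![0, 1; 1, 0]

/-- The Pauli matrix `σ^y`. -/
def pauliY : Matrix (Fin 2) (Fin 2) ℂ := !![0, -Complex.I; Complex.I, 0]

/-- The matrix `A` acting on the spin at site `n`, and the identity on all the other spins. -/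
def siteOp {N : ℕ} (A : Matrix (Fin 2) (Fin 2) ℂ) (n : Fin N) :
    Matrix (Fin N → Fin 2) (Fin N → Fin 2) ℂ :=
  Matrix.of fun s t => if ∀ m, m ≠ n → s m = t m then A (s n) (t n) else 0

/-- The matrix of the XY Hamiltonian
`∑_{n=1}^N (J_x σ_n^x σ_{n+1}^x + J_y σ_n^y σ_{n+1}^y)` with periodic boundary conditions:
`finRotate N` sends each site to its successor, and the last site to the first. -/
def hamiltonianMatrix (N : ℕ) (Jx Jy : ℝ) : Matrix (Fin N → Fin 2) (Fin N → Fin 2) ℂ :=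
  ∑ n : Fin N,
    ((Jx : ℂ) • (siteOp pauliX n * siteOp pauliX (finRotate N n)) +
      (Jy : ℂ) • (siteOp pauliY n * siteOp pauliY (finRotate N n)))

/-- The XY Hamiltonian as an operator on the space of states. -/
def hamiltonian (N : ℕ) (Jx Jy : ℝ) : StateSpace N →ₗ[ℂ] StateSpace N :=
  Matrix.toEuclideanLin (hamiltonianMatrix N Jx Jy)

/-- The theta constant `θ₃(0) = 1 + 2 ∑_{n ≥ 1} q^{n²}` with `q = e^{iπτ}`. -/
def theta3 (τ : ℂ) : ℂ := jacobiTheta₂ 0 τ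

/-- The theta constant `θ₄(0) = 1 + 2 ∑_{n ≥ 1} (-1)^n q^{n²}` with `q = e^{iπτ}`. -/
def theta4 (τ : ℂ) : ℂ := jacobiTheta₂ (1 / 2) τ

/-- The qubit state `ψ(u) = (1, i^u) / √2`. -/
def qubit (u : ℤ) : Fin 2 → ℂ :=
  ![1 / (Real.sqrt 2 : ℂ), Complex.I ^ u / (Real.sqrt 2 : ℂ)]

/-- The position `1, …, N` along the chain of a site. -/
def pos {N : ℕ} (n : Fin N) : ℕ := (n : ℕ) + 1

/-- The chiral basis state `|κ; n₁, …, n_M⟩`: the product state, times the phase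
`(-i)^{n₁ + ⋯ + n_M}`, whose qubit at site `l` is `ψ(l - 2k - κ)`, where `k` is the number of
kinks `n_j` to the left of `l`, that is, with `n_j < l`. -/
def chiralState {N M : ℕ} (κ : ℤ) (n : Fin M → Fin N) : StateSpace N :=
  WithLp.toLp 2 fun s =>
    (-Complex.I) ^ (∑ j, pos (n j)) *
      ∏ l : Fin N,
        qubit ((pos l : ℤ) - 2 * ((Finset.univ.filter fun j => n j < l).card : ℤ) - κ) (s l)

/-- The phase `φ(p) = ½ arctan (((J_x - J_y) / (J_x + J_y)) tan p)`. At a pole of `tan` it has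
its limit from the left, which is `π/4` for `J_x > J_y` and `-π/4` for `J_x < J_y`. -/
def phase (Jx Jy p : ℝ) : ℝ :=
  if Real.cos p = 0 then SignType.sign (Jx - Jy) * (Real.pi / 4)
  else 1 / 2 * Real.arctan ((Jx - Jy) / (Jx + Jy) * Real.tan p)

/-- The one-kink amplitude `exp[i (n p - (-1)^n φ(p))]`. -/
def amplitude (Jx Jy : ℝ) (n : ℕ) (p : ℝ) : ℂ :=
  Complex.exp (Complex.I * ((n * p - (-1) ^ n * phase Jx Jy p : ℝ) : ℂ))

/-- The amplitude `(2 N^M)^{-1/2} det_{j,l} exp[i (n_j p_l - (-1)^{n_j} φ(p_l))]`. -/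
def slaterAmplitude {N M : ℕ} (Jx Jy : ℝ) (n : Fin M → Fin N) (p : Fin M → ℝ) : ℂ :=
  1 / (Real.sqrt (2 * (N : ℝ) ^ M) : ℂ) *
    (Matrix.of fun j l : Fin M => amplitude Jx Jy (pos (n j)) (p l)).det

/-- The state `∑_{n₁ < ⋯ < n_M} ∑_{κ = ±1} χ_n(p) κ^ξ |κ; n⟩`. -/
def bethe (N : ℕ) {M : ℕ} (Jx Jy : ℝ) (ξ : ℕ) (p : Fin M → ℝ) : StateSpace N :=
  ∑ n ∈ Finset.univ.filter (fun n : Fin M → Fin N => StrictMono n),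
    ∑ κ ∈ ({1, -1} : Finset ℤ),
      (slaterAmplitude Jx Jy n p * (κ : ℂ) ^ ξ) • chiralState κ n

/-- The labels of the states: an admissible number `M` of kinks (`0 ≤ M ≤ N`, and `M` has the
parity of `N / 2`), `ξ ∈ {0, 1}`, and `M` quasi-momenta `p₁ < ⋯ < p_M` in the Brillouin zone
`(-π/2, 3π/2]` with `e^{i N p_j} = (-1)^{ξ+1}`. -/
structure Label (N : ℕ) where
  M : ℕ
  M_le : M ≤ N
  parity : M ≡ N / 2 [MOD 2]
  ξ : Fin 2
  p : Fin M → ℝ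
  p_strictMono : StrictMono p
  p_mem : ∀ j, p j ∈ Set.Ioc (-(Real.pi / 2)) (3 * Real.pi / 2)
  p_bethe : ∀ j, Complex.exp (Complex.I * (N : ℂ) * (p j : ℂ)) = (-1) ^ ((ξ : ℕ) + 1)

/-- The state that belongs to a label. -/
def Label.state {N : ℕ} (Jx Jy : ℝ) (a : Label N) : StateSpace N :=
  bethe N Jx Jy (a.ξ : ℕ) a.p

/-- The energy of one kink: `2 √(4 cos² p + (J_x - J_y)²)`, with the sign `+` for
`p ∈ (-π/2, π/2]` and `-` for `p ∈ (π/2, 3π/2]`. -/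
def kinkEnergy (Jx Jy p : ℝ) : ℝ :=
  (if p ≤ Real.pi / 2 then 1 else -1) *
    (2 * Real.sqrt (4 * Real.cos p ^ 2 + (Jx - Jy) ^ 2))

/-- The energy `∑_j ± 2 √(4 cos² p_j + (J_x - J_y)²)` that belongs to a label. -/
def Label.energy {N : ℕ} (Jx Jy : ℝ) (a : Label N) : ℝ :=
  ∑ j, kinkEnergy Jx Jy (a.p j)

end ChiralXY

end

noncomputable section

namespace ChiralXY

open Finset Complex

variable {N M : ℕ}

/-! In a chiral state the angles at the sites alternate in parity, so at each site one of σ^x, σ^y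
is diagonal and the other turns the qubit into the orthogonal one. A bond term thus flips one spin.
The two bonds that meet at a site flip it with amplitudes that cancel unless exactly one kink sits
on the site and its predecessor; the flip then moves that kink across their bond (`hop_coefficient`,
`config_bondSwap`). Hence the Hamiltonian is a nearest-neighbour hopping of hard-core particles with
alternating amplitudes 2J_x and 2J_y.

On a line such particles are free fermions. On the ring, a hop through the boundary collects
(-1)^{N/2} from the phase of the state, (-1)^ξ from κ ↦ -κ, and (-1)^{M-1} from reordering. For
admissible M the product is (-1)^{ξ+1}, whatever M is, so Slater determinants of one-kink
eigenfunctions are eigenvectors and their energies add (`hamiltonian_slaterState`). The one-kink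
problem reduces to E e^{2iφ} = 2(J_x e^{ip} + J_y e^{-ip}). This gives the stated energy because J_x
J_y = 1, which is all that the theta constants contribute (`kinkEnergy_mul_phase`).

Distinct chiral states are orthogonal, so by Cauchy–Binet the inner products are determinants of
one-kink Gram matrices (`inner_slaterState`, `sum_star_amplitude_mul`). Completeness is a count: for
each ξ there are N momenta, and 2^{N-1} sets of them have the admissible parity. -/

/-! ### Pauli matrices on products of the qubits ψ(u) -/

/-- The product vector `v 0 ⊗ ⋯ ⊗ v (N - 1)`. -/
def productState (v : Fin N → Fin 2 → ℂ) : StateSpace N :=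
  WithLp.toLp 2 fun s => ∏ l, v l (s l)

lemma siteOp_productState (A : Matrix (Fin 2) (Fin 2) ℂ) (n : Fin N) (v : Fin N → Fin 2 → ℂ) :
    Matrix.toEuclideanLin (siteOp A n) (productState v) =
      productState (Function.update v n (A.mulVec (v n))) := by
  ext s
  change ∑ t : Fin N → Fin 2,
      (if ∀ m, m ≠ n → s m = t m then A (s n) (t n) else 0) * ∏ l, v l (t l) =
    ∏ l, Function.update v n (A.mulVec (v n)) l (s l)
  have h1 : ∑ b : Fin 2, A (s n) b * ∏ l, v l (Function.update s n b l) =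
      ∑ t : Fin N → Fin 2,
        (if ∀ m, m ≠ n → s m = t m then A (s n) (t n) else 0) * ∏ l, v l (t l) := by
    refine Finset.sum_of_injOn (fun b => Function.update s n b) ?_ (by simp) ?_ ?_
    · exact (Function.update_injective s n).injOn
    · intro t _ ht
      rw [if_neg, zero_mul]
      intro h
      apply ht
      refine ⟨t n, by simp, ?_⟩
      funext m
      by_cases hm : m = n
      · subst hm; simp
      · simp [hm, h m hm]
    · intro b _
      rw [if_pos]
      · simp
      · intro m hm; simp [hm]
  rw [← h1]
  have h2 : ∀ b, ∏ l, v l (Function.update s n b l) = v n b * ∏ l ∈ univ.erase n, v l (s l) := by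
    intro b
    rw [← Finset.mul_prod_erase univ _ (mem_univ n)]
    simp only [Function.update_self]
    congr 1
    refine Finset.prod_congr rfl fun l hl => ?_
    rw [Function.update_of_ne (Finset.ne_of_mem_erase hl)]
  rw [← Finset.mul_prod_erase univ _ (mem_univ n)]
  simp only [Function.update_self, h2, Matrix.mulVec, dotProduct, Finset.sum_mul, mul_assoc]
  refine Finset.sum_congr rfl fun b _ => ?_
  congr 2
  refine Finset.prod_congr rfl fun l hl => ?_
  rw [Function.update_of_ne (Finset.ne_of_mem_erase hl)]

lemma productState_update_smul (v : Fin N → Fin 2 → ℂ) (n : Fin N) (c : ℂ) (w : Fin 2 → ℂ) :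
    productState (Function.update v n (c • w)) = c • productState (Function.update v n w) := by
  ext s
  simp only [productState, PiLp.smul_apply, smul_eq_mul]
  rw [← Finset.mul_prod_erase univ _ (mem_univ n), ← Finset.mul_prod_erase univ _ (mem_univ n)]
  simp only [Function.update_self, Pi.smul_apply, smul_eq_mul, mul_assoc]
  congr 2
  refine Finset.prod_congr rfl fun l hl => ?_
  rw [Function.update_of_ne (Finset.ne_of_mem_erase hl),
    Function.update_of_ne (Finset.ne_of_mem_erase hl)]

lemma I_zpow_congr {u v : ℤ} (h : 4 ∣ u - v) : (I : ℂ) ^ u = I ^ v := by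
  obtain ⟨k, hk⟩ := h
  have : u = v + 4 * k := by omega
  rw [this, zpow_add₀ I_ne_zero, zpow_mul]
  have : (I : ℂ) ^ (4 : ℤ) = 1 := by
    have := I_pow_four
    exact_mod_cast this
  rw [this, one_zpow, mul_one]

lemma qubit_congr {u v : ℤ} (h : 4 ∣ u - v) : qubit u = qubit v := by
  rw [qubit, qubit, I_zpow_congr h]

/-- Modulo 4, -u equals u for even u and u + 2 for odd u: σ^x is diagonal at even angles and flips
at odd ones. For σ^y, where u becomes 2 - u, the roles are exchanged. -/
lemma pauliX_mulVec_qubit (u : ℤ) : pauliX.mulVec (qubit u) = (I : ℂ) ^ u • qubit (-u) := by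
  have h : (I : ℂ) ^ u ≠ 0 := zpow_ne_zero _ I_ne_zero
  ext i
  fin_cases i
  · simp [pauliX, qubit, Matrix.mulVec, dotProduct, div_eq_mul_inv]
  · simp [pauliX, qubit, Matrix.mulVec, dotProduct, div_eq_mul_inv, ← mul_assoc, h]

lemma pauliY_mulVec_qubit (u : ℤ) :
    pauliY.mulVec (qubit u) = (I : ℂ) ^ (u - 1) • qubit (2 - u) := by
  have h : (I : ℂ) ^ u ≠ 0 := zpow_ne_zero _ I_ne_zero
  ext i
  fin_cases i
  · simp [pauliY, qubit, Matrix.mulVec, dotProduct, div_eq_mul_inv, zpow_sub₀]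
    ring
  · simp only [pauliY, qubit, Matrix.mulVec, dotProduct]
    simp [Fin.sum_univ_two, zpow_sub₀ I_ne_zero]
    field_simp

/-- The product state whose qubit at site `l` is `ψ(u l)`. -/
def spinState (u : Fin N → ℤ) : StateSpace N := productState fun l => qubit (u l)

lemma spinState_congr {u v : Fin N → ℤ} (h : ∀ l, 4 ∣ u l - v l) : spinState u = spinState v := by
  unfold spinState
  congr 1
  funext l
  exact qubit_congr (h l)

lemma pauliX_pair_spinState {n m : Fin N} (hnm : n ≠ m) (u w : Fin N → ℤ)
    (hw : ∀ l, l ≠ n → l ≠ m → w l = u l) (hn : 4 ∣ w n + u n) (hm : 4 ∣ w m + u m) :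
    Matrix.toEuclideanLin (siteOp pauliX n * siteOp pauliX m) (spinState u) =
      (I : ℂ) ^ (u n + u m) • spinState w := by
  rw [Matrix.toLpLin_mul_same, LinearMap.comp_apply, spinState, siteOp_productState,
    siteOp_productState, Function.update_of_ne hnm, pauliX_mulVec_qubit, pauliX_mulVec_qubit,
    productState_update_smul, Function.update_comm hnm.symm, productState_update_smul, smul_smul,
    zpow_add₀ I_ne_zero, spinState]
  congr 2
  funext l
  by_cases h1 : l = m
  · subst h1
    rw [Function.update_self]
    exact qubit_congr (by omega)
  · rw [Function.update_of_ne h1]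
    by_cases h2 : l = n
    · subst h2
      rw [Function.update_self]
      exact qubit_congr (by omega)
    · rw [Function.update_of_ne h2, hw l h2 h1]

lemma pauliY_pair_spinState {n m : Fin N} (hnm : n ≠ m) (u w : Fin N → ℤ)
    (hw : ∀ l, l ≠ n → l ≠ m → w l = u l) (hn : 4 ∣ w n + u n - 2) (hm : 4 ∣ w m + u m - 2) :
    Matrix.toEuclideanLin (siteOp pauliY n * siteOp pauliY m) (spinState u) =
      (-(I : ℂ) ^ (u n + u m)) • spinState w := by
  have hI : -(I : ℂ) ^ (u n + u m) = I ^ (u n - 1) * I ^ (u m - 1) := by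
    rw [← zpow_add₀ I_ne_zero, show u n - 1 + (u m - 1) = u n + u m - (2 : ℕ) by push_cast; ring,
      zpow_sub₀ I_ne_zero, zpow_natCast, I_sq]
    ring
  rw [hI, Matrix.toLpLin_mul_same, LinearMap.comp_apply, spinState, siteOp_productState,
    siteOp_productState, Function.update_of_ne hnm, pauliY_mulVec_qubit, pauliY_mulVec_qubit,
    productState_update_smul, Function.update_comm hnm.symm, productState_update_smul, smul_smul,
    spinState]
  congr 2
  funext l
  by_cases h1 : l = m
  · subst h1
    rw [Function.update_self]
    exact qubit_congr (by omega)
  · rw [Function.update_of_ne h1]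
    by_cases h2 : l = n
    · subst h2
      rw [Function.update_self]
      exact qubit_congr (by omega)
    · rw [Function.update_of_ne h2, hw l h2 h1]

/-! ### The Hamiltonian as a sum of single spin flips -/

/-- The configuration `u` with the qubit at site `m` replaced by the orthogonal one. -/
def flipAt (m : Fin N) (u : Fin N → ℤ) : Fin N → ℤ := Function.update u m (u m + 2)

/-- The coupling that belongs to a flip of the spin at site `m`. -/
def coupling (Jx Jy : ℝ) (m : Fin N) : ℝ := if Odd (m : ℕ) then Jx else Jy

/-- The coupling, with a minus sign on the sites at odd positions. -/
def signedCoupling (Jx Jy : ℝ) (m : Fin N) : ℝ := if Odd (m : ℕ) then Jx else -Jy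

lemma coe_finRotate_eq (a : Fin N) :
    ((finRotate N a : Fin N) : ℕ) = if (a : ℕ) + 1 = N then 0 else (a : ℕ) + 1 := by
  cases N with
  | zero => exact a.elim0
  | succ k =>
    rw [coe_finRotate]
    simp only [Fin.ext_iff, Fin.val_last, Nat.add_right_cancel_iff]

lemma finRotate_ne (hN : 2 ≤ N) (a : Fin N) : finRotate N a ≠ a := by
  intro h
  have h1 := coe_finRotate_eq a
  rw [h] at h1
  split_ifs at h1 <;> omega

lemma odd_coe_finRotate (hN : Even N) (a : Fin N) :
    Odd ((finRotate N a : Fin N) : ℕ) ↔ ¬ Odd (a : ℕ) := by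
  rw [coe_finRotate_eq]
  have := a.2
  split_ifs with h <;> grind

/-- The ends of a bond have opposite parities. The σ^x pair is diagonal at the even end and flips
the odd one, the σ^y pair does the opposite; the factor i^{-2} of the σ^y pair is the minus sign in
`signedCoupling`. -/
lemma bond_spinState (hN : Even N) (a : Fin N) (Jx Jy : ℝ) (u : Fin N → ℤ)
    (hu : ∀ l, 2 ∣ u l - (l : ℕ)) :
    Matrix.toEuclideanLin
      ((Jx : ℂ) • (siteOp pauliX a * siteOp pauliX (finRotate N a)) +
        (Jy : ℂ) • (siteOp pauliY a * siteOp pauliY (finRotate N a))) (spinState u) =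
      (I : ℂ) ^ (u a + u (finRotate N a)) •
        ((signedCoupling Jx Jy (finRotate N a) : ℂ) • spinState (flipAt (finRotate N a) u) +
          (signedCoupling Jx Jy a : ℂ) • spinState (flipAt a u)) := by
  have hN2 : 2 ≤ N := by have := a.2; grind
  have hne := finRotate_ne hN2 a
  have hpar := odd_coe_finRotate hN a
  set b := finRotate N a
  have ha := hu a
  have hb := hu b
  have ho : ∀ c : Fin N, ∀ l, l ≠ a → l ≠ b → c = a ∨ c = b → flipAt c u l = u l := by
    rintro c l h1 h2 (rfl | rfl) <;> simp [flipAt, *]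
  have e1 : flipAt a u a = u a + 2 := by simp [flipAt]
  have e2 : flipAt b u b = u b + 2 := by simp [flipAt]
  have e3 : flipAt a u b = u b := by simp [flipAt, hne]
  have e4 : flipAt b u a = u a := by simp [flipAt, hne.symm]
  rw [map_add, map_smul, map_smul, LinearMap.add_apply, LinearMap.smul_apply, LinearMap.smul_apply]
  by_cases h : Odd (a : ℕ)
  · have h' : ¬ Odd (b : ℕ) := by tauto
    rw [pauliX_pair_spinState hne.symm u (flipAt a u) (fun l h1 h2 => ho a l h1 h2 (Or.inl rfl))
        (by rw [e1]; grind) (by rw [e3]; grind),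
      pauliY_pair_spinState hne.symm u (flipAt b u) (fun l h1 h2 => ho b l h1 h2 (Or.inr rfl))
        (by rw [e4]; grind) (by rw [e2]; grind)]
    simp only [signedCoupling, h, h', if_true, if_false]
    push_cast
    module
  · have h' : Odd (b : ℕ) := by tauto
    rw [pauliX_pair_spinState hne.symm u (flipAt b u) (fun l h1 h2 => ho b l h1 h2 (Or.inr rfl))
        (by rw [e4]; grind) (by rw [e2]; grind),
      pauliY_pair_spinState hne.symm u (flipAt a u) (fun l h1 h2 => ho a l h1 h2 (Or.inl rfl))
        (by rw [e1]; grind) (by rw [e3]; grind)]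
    simp only [signedCoupling, h, h', if_true, if_false]
    push_cast
    module

/-- Each site is an end of two bonds; shifting the index of one of the two sums collects both
contributions to the flip of that site. -/
lemma hamiltonian_spinState (hN : Even N) (Jx Jy : ℝ) (u : Fin N → ℤ)
    (hu : ∀ l, 2 ∣ u l - (l : ℕ)) :
    hamiltonian N Jx Jy (spinState u) =
      ∑ a, ((signedCoupling Jx Jy (finRotate N a) : ℂ) * I ^ u (finRotate N a) *
        (I ^ u a + I ^ u (finRotate N (finRotate N a)))) •
          spinState (flipAt (finRotate N a) u) := by
  rw [hamiltonian, hamiltonianMatrix, map_sum, LinearMap.sum_apply]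
  simp only [bond_spinState hN _ Jx Jy u hu, smul_add, sum_add_distrib]
  rw [← Equiv.sum_comp (finRotate N) (fun a => (I : ℂ) ^ (u a + u (finRotate N a)) •
    (signedCoupling Jx Jy a : ℂ) • spinState (flipAt a u)), ← sum_add_distrib]
  refine sum_congr rfl fun a _ => ?_
  rw [zpow_add₀ I_ne_zero, zpow_add₀ I_ne_zero]
  module

/-! ### Kinks and the hopping form of the Hamiltonian -/

/-- The number of kinks at a site. -/
def kinkCount (n : Fin M → Fin N) (x : Fin N) : ℕ := (univ.filter fun j => n j = x).card

/-- The angles of the qubits in the state `|κ; n⟩`. -/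
def config (κ : ℤ) (n : Fin M → Fin N) (l : Fin N) : ℤ :=
  (pos l : ℤ) - 2 * ((univ.filter fun j => n j < l).card : ℤ) - κ

lemma chiralState_eq (κ : ℤ) (n : Fin M → Fin N) :
    chiralState κ n = (-I) ^ (∑ j, pos (n j)) • spinState (config κ n) := by
  ext s
  simp [chiralState, spinState, productState, config]

lemma kinkCount_le_one {n : Fin M → Fin N} (hn : Function.Injective n) (x : Fin N) :
    kinkCount n x ≤ 1 := by
  rw [kinkCount, card_le_one]
  intro i hi j hj
  simp only [mem_filter, mem_univ, true_and] at hi hj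
  exact hn (hi.trans hj.symm)

lemma kinkCount_eq_one_iff {n : Fin M → Fin N} (hn : Function.Injective n) (x : Fin N) :
    kinkCount n x = 1 ↔ x ∈ Set.range n := by
  constructor
  · intro h
    obtain ⟨j, hj⟩ := card_eq_one.1 h
    have : j ∈ univ.filter fun j => n j = x := by rw [hj]; simp
    exact ⟨j, by simpa using this⟩
  · rintro ⟨j, rfl⟩
    have h1 := kinkCount_le_one hn (n j)
    have h2 : 0 < kinkCount n (n j) := card_pos.2 ⟨j, by simp⟩
    omega

/-- The angle grows by 1 per site and by -1 across a kink. Going once around the ring the defect is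
N - 2M, which admissibility makes a multiple of 4. -/
lemma config_finRotate (hM : M ≡ N / 2 [MOD 2]) (hN : Even N) (κ : ℤ) (n : Fin M → Fin N)
    (a : Fin N) :
    4 ∣ config κ n (finRotate N a) - (config κ n a + 1 - 2 * kinkCount n a) := by
  have hr := coe_finRotate_eq a
  set b := finRotate N a
  have ha := a.2
  have h4 : (4 : ℤ) ∣ N - 2 * M := by
    unfold Nat.ModEq at hM
    obtain ⟨k, rfl⟩ := hN
    omega
  simp only [config, kinkCount, pos, natCast_card_filter]
  push_cast
  split_ifs at hr with h
  · have h1 : ∀ j, (if n j < b then (1 : ℤ) else 0) = 0 := by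
      intro j
      rw [if_neg]
      intro hj
      have := Fin.lt_def.1 hj
      omega
    have h2 : ∑ j, (if n j < a then (1 : ℤ) else 0) + ∑ j, (if n j = a then (1 : ℤ) else 0) = M := by
      rw [← sum_add_distrib]
      rw [sum_congr rfl (g := fun _ => (1 : ℤ))]
      · simp
      · intro j _
        have := (n j).2
        simp only [Fin.lt_def, Fin.ext_iff]
        split_ifs <;> omega
    simp only [h1, sum_const_zero]
    omega
  · have h2 : ∑ j, (if n j < b then (1 : ℤ) else 0) =
        ∑ j, (if n j < a then (1 : ℤ) else 0) + ∑ j, (if n j = a then (1 : ℤ) else 0) := by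
      rw [← sum_add_distrib]
      refine sum_congr rfl fun j _ => ?_
      simp only [Fin.lt_def, Fin.ext_iff]
      split_ifs <;> omega
    rw [h2]
    omega

lemma two_dvd_config {κ : ℤ} (hκ : κ = 1 ∨ κ = -1) (n : Fin M → Fin N) (l : Fin N) :
    2 ∣ config κ n l - (l : ℕ) := by
  simp only [config, pos]
  push_cast
  rcases hκ with rfl | rfl <;> omega

/-- The exchange of a site with its successor. -/
def bondSwap (a : Fin N) : Equiv.Perm (Fin N) := Equiv.swap a (finRotate N a)

/-- In the bulk, moving a kink across the bond changes the kink count only at the right end, by ±1,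
hence the angle there by 2 modulo 4. Across the boundary the count changes at every site but the
first, and κ ↦ -κ shifts all angles by 2 modulo 4, so again only one site differs. -/
lemma config_bondSwap (hN : 2 ≤ N) {κ : ℤ} (hκ : κ = 1 ∨ κ = -1) (n : Fin M → Fin N) (a : Fin N)
    (h1 : kinkCount n a + kinkCount n (finRotate N a) = 1) (l : Fin N) :
    4 ∣ flipAt (finRotate N a) (config κ n) l -
      config (if (a : ℕ) + 1 = N then -κ else κ) (bondSwap a ∘ n) l := by
  have hne := finRotate_ne hN a
  have hr := coe_finRotate_eq a
  unfold bondSwap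
  set b := finRotate N a
  have ha := a.2
  have hl := l.2
  have hn : (univ.filter fun j => (Equiv.swap a b ∘ n) j < l).card =
    ((univ.filter fun j => (Equiv.swap a b (n j)) < l).card) := rfl
  have hf : flipAt b (config κ n) l = config κ n l + if l = b then 2 else 0 := by
    by_cases h : l = b
    · subst h; simp [flipAt]
    · simp [flipAt, h]
  rw [hf]
  zify at h1
  simp only [config, hn, natCast_card_filter, kinkCount] at h1 ⊢
  -- Only kinks on the bond contribute to the change, through the difference of the occupations of
  -- its two ends.
  have key : ∑ j, (if Equiv.swap a b (n j) < l then (1 : ℤ) else 0) =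
      ∑ j, (if n j < l then (1 : ℤ) else 0) +
        (if b < l then 1 else 0) * (∑ j, (if n j = a then (1 : ℤ) else 0) -
          ∑ j, (if n j = b then (1 : ℤ) else 0)) -
        (if a < l then 1 else 0) * (∑ j, (if n j = a then (1 : ℤ) else 0) -
          ∑ j, (if n j = b then (1 : ℤ) else 0)) := by
    rw [← sum_sub_distrib, mul_sum, mul_sum, ← sum_add_distrib, ← sum_sub_distrib]
    refine sum_congr rfl fun j _ => ?_
    rw [Equiv.swap_apply_def]
    by_cases e1 : n j = a
    · rw [e1]; simp [hne.symm]
    · by_cases e2 : n j = b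
      · rw [e2]; simp [hne]
      · simp [e1, e2]
  rw [key]
  set A := ∑ j, (if n j = a then (1 : ℤ) else 0)
  set B := ∑ j, (if n j = b then (1 : ℤ) else 0)
  set C := ∑ j, (if n j < l then (1 : ℤ) else 0)
  have hB : B = 1 - A := by omega
  simp only [Fin.lt_def, Fin.ext_iff, pos]
  split_ifs at hr ⊢ <;> rcases hκ with rfl | rfl <;> omega

lemma sum_pos_bondSwap (hN : 2 ≤ N) (n : Fin M → Fin N) (a : Fin N) :
    ((∑ j, pos ((bondSwap a ∘ n) j) : ℕ) : ℤ) = (∑ j, pos (n j) : ℕ) +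
      ((kinkCount n a : ℤ) - kinkCount n (finRotate N a)) *
        ((finRotate N a : ℕ) - (a : ℕ)) := by
  have hne := finRotate_ne hN a
  unfold bondSwap
  set b := finRotate N a
  simp only [kinkCount, natCast_card_filter]
  push_cast
  rw [← sum_sub_distrib, sum_mul, ← sum_add_distrib]
  refine sum_congr rfl fun j _ => ?_
  simp only [Function.comp, Equiv.swap_apply_def, pos]
  by_cases e1 : n j = a
  · rw [e1]; simp [hne.symm]; ring
  · by_cases e2 : n j = b
    · rw [e2]; simp [hne]; ring
    · simp [e1, e2]

/-- The sign of the boundary hop, and one for the other hops. -/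
def boundarySign (s : ℂ) (a : Fin N) : ℂ := if (a : ℕ) + 1 = N then s else 1

lemma I_zpow_two_mul_of_even {u : ℤ} (h : Even u) : (I : ℂ) ^ (2 * u) = 1 := by
  rw [show (1 : ℂ) = I ^ (0 : ℤ) by simp]
  exact I_zpow_congr (by grind)

lemma I_zpow_two_mul_of_odd {u : ℤ} (h : Odd u) : (I : ℂ) ^ (2 * u) = -1 := by
  rw [← I_sq, ← zpow_natCast]
  exact I_zpow_congr (by push_cast; grind)

/-- Across the boundary the position jumps by 1 - N instead of 1, and (-i)^{∓N} = (-1)^{N/2}. -/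
lemma neg_I_zpow_bond (hN : Even N) (a : Fin N) (d : ℤ) (hd : d = 1 ∨ d = -1) :
    (-I : ℂ) ^ (d * ((finRotate N a : ℕ) - (a : ℕ) : ℤ)) =
      -I * d * boundarySign ((-1) ^ (N / 2)) a := by
  have hr := coe_finRotate_eq a
  have hI : (-I : ℂ) ≠ 0 := by simp
  have h1 : (-I : ℂ) ^ d = -I * d := by
    rcases hd with rfl | rfl <;> simp
  unfold boundarySign
  split_ifs at hr ⊢ with h
  · rw [hr]
    obtain ⟨k, hk⟩ := hN
    have h2 : d * (((0 : ℕ) : ℤ) - (a : ℕ)) = d + -(2 * (k * d)) := by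
      have : ((a : ℕ) : ℤ) = 2 * k - 1 := by omega
      rw [this]; push_cast; ring
    have h3 : (-I : ℂ) ^ (-(2 * (k * d))) = (-1) ^ (N / 2) := by
      rw [zpow_neg, zpow_mul]
      have : (-I : ℂ) ^ (2 : ℤ) = -1 := by
        rw [show (2 : ℤ) = ((2 : ℕ) : ℤ) by rfl, zpow_natCast, neg_sq, I_sq]
      rw [this, show N / 2 = k by omega]
      rcases hd with rfl | rfl
      · rw [mul_one, zpow_natCast]
        rcases neg_one_pow_eq_or ℂ k with h | h <;> rw [h] <;> norm_num
      · rw [← zpow_neg, mul_neg, mul_one, neg_neg, zpow_natCast]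
    rw [h2, zpow_add₀ hI, h1, h3]
  · rw [hr]
    have h2 : d * ((((a : ℕ) + 1 : ℕ) : ℤ) - (a : ℕ)) = d := by push_cast; ring
    rw [h2, h1, mul_one]

/-- The neighbours of b enter as i^{2k_a - 1} + i^{1 - 2k_b}, where k_a and k_b are the kink numbers
at a and b. This vanishes when they are equal and is ±2i otherwise. -/
lemma hop_coefficient (hM : M ≡ N / 2 [MOD 2]) (hN : Even N) {κ : ℤ} (hκ : κ = 1 ∨ κ = -1)
    {n : Fin M → Fin N} (hn : Function.Injective n) (a : Fin N) (Jx Jy : ℝ) :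
    ((signedCoupling Jx Jy (finRotate N a) : ℂ) * I ^ config κ n (finRotate N a) *
      (I ^ config κ n a + I ^ config κ n (finRotate N (finRotate N a)))) =
    -2 * I * coupling Jx Jy (finRotate N a) *
      ((kinkCount n a : ℂ) - kinkCount n (finRotate N a)) := by
  have h1 := config_finRotate hM hN κ n a
  have h2 := config_finRotate hM hN κ n (finRotate N a)
  have h3 := kinkCount_le_one hn a
  have h4 := kinkCount_le_one hn (finRotate N a)
  have h5 := two_dvd_config hκ n (finRotate N a)
  set b := finRotate N a
  set c := finRotate N b
  have e1 : (I : ℂ) ^ config κ n a = I ^ (config κ n b + 2 * kinkCount n a - 1) :=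
    I_zpow_congr (by omega)
  have e2 : (I : ℂ) ^ config κ n c = I ^ (config κ n b + 1 - 2 * kinkCount n b) :=
    I_zpow_congr (by omega)
  rw [e1, e2]
  -- The angle has the parity of its site, so the square of i^u undoes the staggered sign of the
  -- coupling.
  have e3 : (signedCoupling Jx Jy b : ℂ) * I ^ (2 * config κ n b) = - coupling Jx Jy b := by
    unfold signedCoupling coupling
    split_ifs with h
    · rw [I_zpow_two_mul_of_odd (by grind)]; ring
    · rw [I_zpow_two_mul_of_even (by grind)]; push_cast; ring
  have e4 : ∀ x y : ℤ, (signedCoupling Jx Jy b : ℂ) * I ^ config κ n b *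
      (I ^ (config κ n b + x) + I ^ (config κ n b + y)) =
      - coupling Jx Jy b * (I ^ x + I ^ y) := by
    intro x y
    rw [← e3, two_mul, zpow_add₀ I_ne_zero, zpow_add₀ I_ne_zero, zpow_add₀ I_ne_zero]
    ring
  rw [add_sub_assoc, add_sub_assoc, e4]
  interval_cases kinkCount n a <;> interval_cases kinkCount n b <;> simp <;> ring

/-- The prefactor (-i)^{n_1+⋯+n_M} is what makes the hopping amplitudes real: it absorbs the
direction-dependent factor ∓2i of a hop. -/
lemma hamiltonian_chiralState (hM : M ≡ N / 2 [MOD 2]) (hN : Even N) {κ : ℤ}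
    (hκ : κ = 1 ∨ κ = -1) {n : Fin M → Fin N} (hn : Function.Injective n) (Jx Jy : ℝ) :
    hamiltonian N Jx Jy (chiralState κ n) =
      ∑ a, if kinkCount n a + kinkCount n (finRotate N a) = 1 then
        (2 * coupling Jx Jy (finRotate N a) * boundarySign ((-1) ^ (N / 2)) a : ℂ) •
          chiralState (if (a : ℕ) + 1 = N then -κ else κ) (bondSwap a ∘ n) else 0 := by
  rw [chiralState_eq, map_smul, hamiltonian_spinState hN Jx Jy _ (two_dvd_config hκ n), smul_sum]
  refine sum_congr rfl fun a _ => ?_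
  have hN2 : 2 ≤ N := by have := a.2; grind
  rw [hop_coefficient hM hN hκ hn]
  have h3 := kinkCount_le_one hn a
  have h4 := kinkCount_le_one hn (finRotate N a)
  have hs := sum_pos_bondSwap hN2 n a
  by_cases h : kinkCount n a + kinkCount n (finRotate N a) = 1
  · rw [if_pos h, chiralState_eq, spinState_congr (config_bondSwap hN2 hκ n a h), smul_smul,
      smul_smul]
    congr 1
    set d : ℤ := (kinkCount n a : ℤ) - kinkCount n (finRotate N a) with hd
    have hd1 : d = 1 ∨ d = -1 := by omega
    have hI : (-I : ℂ) ≠ 0 := by simp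
    have e1 : (-I : ℂ) ^ (∑ j, pos ((bondSwap a ∘ n) j)) =
        (-I) ^ (∑ j, pos (n j)) * (-I * d * boundarySign ((-1) ^ (N / 2)) a) := by
      rw [← zpow_natCast, hs, zpow_add₀ hI, neg_I_zpow_bond hN a d hd1, zpow_natCast]
    have e2 : boundarySign ((-1 : ℂ) ^ (N / 2)) a * boundarySign ((-1) ^ (N / 2)) a = 1 := by
      unfold boundarySign
      split_ifs
      · rw [← mul_pow]; simp
      · simp
    have e3 : (kinkCount n a : ℂ) - kinkCount n (finRotate N a) = d := by
      rw [hd]; push_cast; ring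
    rw [e1, e3]
    linear_combination (2 * I * d * (-I) ^ (∑ j, pos (n j)) * coupling Jx Jy (finRotate N a)) * e2
  · have : kinkCount n a = kinkCount n (finRotate N a) := by omega
    rw [if_neg h, this]
    simp

/-! ### Sorting signs of kink tuples -/

/-- The sign of the permutation that sorts `n`, and zero if `n` is not injective. -/
def tupleSign (n : Fin M → Fin N) : ℤ :=
  ∏ i, ∏ j ∈ Ioi i, ((SignType.sign (((n j : ℕ) : ℤ) - (n i : ℕ)) : SignType) : ℤ)

/-- Reading the sign off a Vandermonde determinant yields antisymmetry, and vanishing on repeated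
entries, from the properties of determinants. -/
lemma tupleSign_eq_sign_det (n : Fin M → Fin N) :
    tupleSign n =
      (SignType.sign (Matrix.vandermonde fun j => ((n j : ℕ) : ℤ)).det : SignType) := by
  rw [Matrix.det_vandermonde, tupleSign]
  change _ = SignType.castHom (signHom _)
  simp only [map_prod]
  rfl

lemma tupleSign_comp_perm (n : Fin M → Fin N) (σ : Equiv.Perm (Fin M)) :
    tupleSign (n ∘ σ) = Equiv.Perm.sign σ * tupleSign n := by
  have h : (Matrix.vandermonde fun j => (((n ∘ σ) j : ℕ) : ℤ)).det =
      Equiv.Perm.sign σ * (Matrix.vandermonde fun j => ((n j : ℕ) : ℤ)).det := by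
    refine (Matrix.det_permute σ (Matrix.vandermonde fun j => ((n j : ℕ) : ℤ))).trans ?_
    simp
  rw [tupleSign_eq_sign_det, tupleSign_eq_sign_det, h, sign_mul]
  rcases Int.units_eq_one_or (Equiv.Perm.sign σ) with h | h <;> rw [h] <;> simp

lemma tupleSign_eq_zero {n : Fin M → Fin N} (hn : ¬ Function.Injective n) : tupleSign n = 0 := by
  rw [tupleSign_eq_sign_det, Matrix.det_vandermonde_eq_zero_iff.2]
  · simp
  · simp only [Function.Injective, not_forall] at hn
    obtain ⟨i, j, h, hij⟩ := hn
    exact ⟨i, j, by rw [h], hij⟩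

lemma tupleSign_of_strictMono {n : Fin M → Fin N} (hn : StrictMono n) : tupleSign n = 1 := by
  refine prod_eq_one fun i _ => prod_eq_one fun j hj => ?_
  have : (n i : ℕ) < n j := hn (mem_Ioi.1 hj)
  rw [sign_pos (by omega)]
  simp

lemma prod_pairs_neg_one (j₀ : Fin M) :
    ∏ i, ∏ j ∈ Ioi i, (if i = j₀ ∨ j = j₀ then (-1 : ℤ) else 1) = (-1) ^ (M - 1) := by
  have h : ∀ i, ∏ j ∈ Ioi i, (if i = j₀ ∨ j = j₀ then (-1 : ℤ) else 1) =
      (if i ∈ Iio j₀ then -1 else 1) * (if i = j₀ then (-1) ^ (M - 1 - (j₀ : ℕ)) else 1) := by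
    intro i
    rcases lt_trichotomy i j₀ with hi | rfl | hi
    · rw [if_pos (mem_Iio.2 hi), if_neg hi.ne, mul_one, prod_eq_single j₀]
      · simp
      · intro j _ hj; simp [hi.ne, hj]
      · intro h; simp [hi] at h
    · simp
    · rw [if_neg (by simp [hi.le]), if_neg hi.ne', mul_one]
      refine prod_eq_one fun j hj => ?_
      have := (hi.trans (mem_Ioi.1 hj)).ne'
      simp [hi.ne', this]
  have := j₀.2
  simp only [h, prod_mul_distrib, prod_ite_eq', mem_univ, if_true]
  rw [prod_ite_mem, univ_inter, prod_const, Fin.card_Iio, ← pow_add]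
  congr 1
  omega

lemma exists_unique_kink {n : Fin M → Fin N} {a b : Fin N} (hab : a ≠ b)
    (h : kinkCount n a + kinkCount n b = 1) :
    ∃ j₀, ∀ j, (n j = a ∨ n j = b) ↔ j = j₀ := by
  have h1 : (univ.filter fun j => n j = a ∨ n j = b).card = 1 := by
    rw [filter_or, card_union_of_disjoint]
    · exact h
    · rw [disjoint_filter]
      intro j _ h1 h2
      exact hab (h1.symm.trans h2)
  obtain ⟨j₀, hj⟩ := card_eq_one.1 h1
  refine ⟨j₀, fun j => ?_⟩
  have := Finset.ext_iff.1 hj j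
  simpa using this

/-- A single kink that moves to an adjacent site overtakes no other kink; one that crosses the
boundary overtakes all M - 1 others. -/
lemma tupleSign_bondSwap (hN : 2 ≤ N) {n : Fin M → Fin N} (a : Fin N)
    (h : kinkCount n a + kinkCount n (finRotate N a) = 1) :
    (tupleSign (bondSwap a ∘ n) : ℂ) = boundarySign ((-1) ^ (M - 1)) a * tupleSign n := by
  have hne := finRotate_ne hN a
  have hr := coe_finRotate_eq a
  obtain ⟨j₀, hj₀⟩ := exists_unique_kink hne.symm h
  have key : tupleSign (bondSwap a ∘ n) =
      (if (a : ℕ) + 1 = N then (-1) ^ (M - 1) else 1) * tupleSign n := by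
    have h2 : tupleSign (bondSwap a ∘ n) =
        (∏ i, ∏ j ∈ Ioi i, (if (a : ℕ) + 1 = N then (if i = j₀ ∨ j = j₀ then (-1 : ℤ) else 1)
          else 1)) * tupleSign n := by
      unfold tupleSign bondSwap
      rw [← prod_mul_distrib]
      refine prod_congr rfl fun i _ => ?_
      rw [← prod_mul_distrib]
      refine prod_congr rfl fun j hj => ?_
      have hij : i ≠ j := (mem_Ioi.1 hj).ne
      have h3 : ∀ k, k ≠ j₀ → Equiv.swap a (finRotate N a) (n k) = n k ∧ n k ≠ a ∧
          n k ≠ finRotate N a := by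
        intro k hk
        have := (hj₀ k).not.2 hk
        push Not at this
        exact ⟨Equiv.swap_apply_of_ne_of_ne this.1 this.2, this.1, this.2⟩
      have h4 : (n j₀ = a ∧ Equiv.swap a (finRotate N a) (n j₀) = finRotate N a) ∨
          (n j₀ = finRotate N a ∧ Equiv.swap a (finRotate N a) (n j₀) = a) := by
        rcases (hj₀ j₀).2 rfl with h | h <;> rw [h] <;> simp
      set b := finRotate N a
      simp only [Function.comp]
      have hs : ∀ x y : ℤ, (0 < x ∧ 0 < y) ∨ (x < 0 ∧ y < 0) →
          ((SignType.sign x : SignType) : ℤ) = (SignType.sign y : SignType) := by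
        rintro x y (⟨h1, h2⟩ | ⟨h1, h2⟩)
        · rw [sign_pos h1, sign_pos h2]
        · rw [sign_neg h1, sign_neg h2]
      have hs' : ∀ x y : ℤ, (0 < x ∧ y < 0) ∨ (x < 0 ∧ 0 < y) →
          ((SignType.sign x : SignType) : ℤ) = -1 * (SignType.sign y : SignType) := by
        rintro x y (⟨h1, h2⟩ | ⟨h1, h2⟩)
        · rw [sign_pos h1, sign_neg h2]; simp
        · rw [sign_neg h1, sign_pos h2]; simp
      by_cases hi : i = j₀
      · subst hi
        obtain ⟨e1, e2, e3⟩ := h3 j hij.symm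
        rw [e1]
        rw [ne_eq, Fin.ext_iff] at e2 e3
        have := (n j).2
        simp only [true_or, if_true]
        rcases h4 with ⟨h4, h5⟩ | ⟨h4, h5⟩ <;> rw [h5, h4] <;> split_ifs at hr ⊢
        · exact hs' _ _ (by omega)
        · rw [one_mul]; exact hs _ _ (by omega)
        · exact hs' _ _ (by omega)
        · rw [one_mul]; exact hs _ _ (by omega)
      · obtain ⟨e1, e2, e3⟩ := h3 i hi
        rw [e1]
        rw [ne_eq, Fin.ext_iff] at e2 e3
        have := (n i).2
        by_cases hj' : j = j₀
        · subst hj'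
          simp only [or_true, if_true]
          rcases h4 with ⟨h4, h5⟩ | ⟨h4, h5⟩ <;> rw [h5, h4] <;> split_ifs at hr ⊢
          · exact hs' _ _ (by omega)
          · rw [one_mul]; exact hs _ _ (by omega)
          · exact hs' _ _ (by omega)
          · rw [one_mul]; exact hs _ _ (by omega)
        · rw [(h3 j hj').1]
          simp [hi, hj']
    rw [h2]
    split_ifs
    · rw [prod_pairs_neg_one]
    · simp
  rw [key, boundarySign]
  push_cast
  split_ifs <;> simp

lemma sum_eq_sum_strictMono {V : Type*} [AddCommMonoid V] (h : (Fin M → Fin N) → V)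
    (h0 : ∀ n, ¬ Function.Injective n → h n = 0) :
    ∑ n, h n = ∑ s ∈ univ.filter (fun n : Fin M → Fin N => StrictMono n),
      ∑ σ : Equiv.Perm (Fin M), h (s ∘ σ) := by
  rw [← sum_product', eq_comm]
  refine sum_of_injOn (fun x => x.1 ∘ x.2) ?_ (by simp) ?_ (fun _ _ => rfl)
  · rintro ⟨s, σ⟩ hs ⟨t, ρ⟩ ht hst
    simp only [coe_product, Set.mem_prod, mem_coe, mem_filter, mem_univ, true_and, and_true,
      coe_univ, Set.mem_univ] at hs ht hst
    have hr : Set.range s = Set.range t := by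
      rw [← EquivLike.range_comp s σ, hst, EquivLike.range_comp t ρ]
    have : s = t := (StrictMono.range_inj hs ht).1 hr
    subst this
    congr 1
    ext j
    have := hs.injective (congrFun hst j)
    exact congrArg _ this
  · intro n _ hn
    apply h0
    intro hinj
    apply hn
    refine ⟨(n ∘ Tuple.sort n, (Tuple.sort n)⁻¹), ?_, ?_⟩
    · simp only [coe_product, Set.mem_prod, mem_coe, mem_filter, mem_univ, true_and, and_true,
        coe_univ, Set.mem_univ]
      exact (Tuple.monotone_sort n).strictMono_of_injective
        (hinj.comp (Tuple.sort n).injective)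
    · funext j
      simp

lemma chiralState_comp_perm (κ : ℤ) (n : Fin M → Fin N) (σ : Equiv.Perm (Fin M)) :
    chiralState κ (n ∘ σ) = chiralState κ n := by
  rw [chiralState_eq, chiralState_eq]
  congr 1
  · congr 1
    exact Equiv.sum_comp σ fun j => pos (n j)
  · congr 1
    funext l
    simp only [config, natCast_card_filter]
    rw [← Equiv.sum_comp σ fun j => if n j < l then (1 : ℤ) else 0]
    rfl

/-! ### Slater states and the reduction to one kink -/

/-- The combination `∑_κ κ^ξ |κ; n⟩`. -/
def kinkState (ξ : ℕ) (n : Fin M → Fin N) : StateSpace N :=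
  ∑ κ ∈ ({1, -1} : Finset ℤ), ((κ : ℂ) ^ ξ) • chiralState κ n

lemma kinkState_comp_perm (ξ : ℕ) (n : Fin M → Fin N) (σ : Equiv.Perm (Fin M)) :
    kinkState ξ (n ∘ σ) = kinkState ξ n := by
  simp only [kinkState, chiralState_comp_perm]

/-- The state `∑_n (∏_j f_j(n_j)) |n⟩`, antisymmetrized in the kinks. -/
def slaterState (ξ : ℕ) (f : Fin M → Fin N → ℂ) : StateSpace N :=
  ∑ n : Fin M → Fin N, ((tupleSign n : ℂ) * ∏ j, f j (n j)) • kinkState ξ n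

lemma slaterState_eq (ξ : ℕ) (f : Fin M → Fin N → ℂ) :
    slaterState ξ f = ∑ n ∈ univ.filter (fun n : Fin M → Fin N => StrictMono n),
      (Matrix.of fun j l : Fin M => f l (n j)).det • kinkState ξ n := by
  rw [slaterState, sum_eq_sum_strictMono]
  · refine sum_congr rfl fun n hn => ?_
    simp only [kinkState_comp_perm, ← sum_smul]
    congr 1
    rw [Matrix.det_apply']
    refine sum_congr rfl fun σ _ => ?_
    rw [tupleSign_comp_perm, tupleSign_of_strictMono (mem_filter.1 hn).2]
    simp
  · intro n hn
    rw [tupleSign_eq_zero hn]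
    simp

lemma bethe_eq (Jx Jy : ℝ) (ξ : ℕ) (p : Fin M → ℝ) :
    bethe N Jx Jy ξ p = (1 / (Real.sqrt (2 * (N : ℝ) ^ M) : ℂ)) •
      slaterState ξ (fun j x => amplitude Jx Jy (pos x) (p j)) := by
  rw [bethe, slaterState_eq, smul_sum]
  refine sum_congr rfl fun n _ => ?_
  rw [kinkState, smul_sum, smul_sum]
  refine sum_congr rfl fun κ _ => ?_
  rw [slaterAmplitude, smul_smul, smul_smul]

lemma kinkCount_bondSwap_left (n : Fin M → Fin N) (a : Fin N) :
    kinkCount (bondSwap a ∘ n) a = kinkCount n (finRotate N a) := by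
  unfold kinkCount bondSwap
  congr 1
  ext j
  simp only [mem_filter, mem_univ, true_and, Function.comp]
  rw [← Equiv.eq_symm_apply, Equiv.symm_swap, Equiv.swap_apply_left]

lemma kinkCount_bondSwap_right (n : Fin M → Fin N) (a : Fin N) :
    kinkCount (bondSwap a ∘ n) (finRotate N a) = kinkCount n a := by
  unfold kinkCount bondSwap
  congr 1
  ext j
  simp only [mem_filter, mem_univ, true_and, Function.comp]
  rw [← Equiv.eq_symm_apply, Equiv.symm_swap, Equiv.swap_apply_right]

lemma bondSwap_comp_bondSwap (a : Fin N) (n : Fin M → Fin N) :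
    bondSwap a ∘ (bondSwap a ∘ n) = n := by
  funext j
  simp [bondSwap]

lemma injective_bondSwap_comp {n : Fin M → Fin N} (a : Fin N) :
    Function.Injective (bondSwap a ∘ n) ↔ Function.Injective n :=
  (bondSwap a).injective.of_comp_iff n

lemma sum_bondSwap {V : Type*} [AddCommMonoid V] (a : Fin N) (h : (Fin M → Fin N) → V) :
    ∑ n, h (bondSwap a ∘ n) = ∑ n, h n :=
  Equiv.sum_comp ((Equiv.refl (Fin M)).arrowCongr (bondSwap a)) h

/-- The combination over κ diagonalizes the reversal κ ↦ -κ at the boundary, which becomes the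
factor (-1)^ξ. -/
lemma hamiltonian_kinkState (hM : M ≡ N / 2 [MOD 2]) (hN : Even N) (ξ : ℕ)
    {n : Fin M → Fin N} (hn : Function.Injective n) (Jx Jy : ℝ) :
    hamiltonian N Jx Jy (kinkState ξ n) =
      ∑ a, if kinkCount n a + kinkCount n (finRotate N a) = 1 then
        (2 * coupling Jx Jy (finRotate N a) * boundarySign ((-1) ^ (N / 2 + ξ)) a : ℂ) •
          kinkState ξ (bondSwap a ∘ n) else 0 := by
  simp only [kinkState, sum_pair (show (1 : ℤ) ≠ -1 by decide), map_add, map_smul]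
  rw [hamiltonian_chiralState hM hN (Or.inl rfl) hn, hamiltonian_chiralState hM hN (Or.inr rfl) hn,
    smul_sum, smul_sum, ← sum_add_distrib]
  refine sum_congr rfl fun a _ => ?_
  split_ifs with h1 h2
  · simp only [boundarySign, h2, if_true, neg_neg, pow_add]
    push_cast
    have : ((-1 : ℂ) ^ ξ) * (-1) ^ ξ = 1 := by rw [← mul_pow]; simp
    simp only [one_pow, one_smul, smul_add, smul_smul]
    rw [show (2 * (coupling Jx Jy (finRotate N a) : ℂ) * ((-1) ^ (N / 2) * (-1) ^ ξ) * (-1) ^ ξ) =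
      2 * (coupling Jx Jy (finRotate N a) : ℂ) * ((-1) ^ (N / 2)) by
        linear_combination (2 * (coupling Jx Jy (finRotate N a) : ℂ) * ((-1) ^ (N / 2))) * this]
    rw [add_comm]
    congr 2 <;> ring
  · simp only [boundarySign, h2, if_false]
    module
  · simp

/-- The hop of a single kink across the bond of `a` with its successor. -/
def hop (w : ℂ) (a : Fin N) (f : Fin N → ℂ) (x : Fin N) : ℂ :=
  if x = a ∨ x = finRotate N a then w * f (bondSwap a x) else 0

/-- The amplitude of the state in which one kink after the other has hopped. -/
def hopSum (w : ℂ) (a : Fin N) (f : Fin M → Fin N → ℂ) (n : Fin M → Fin N) : ℂ :=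
  ∑ k, (∏ i ∈ univ.erase k, f i (n i)) * hop w a (f k) (n k)

lemma hopSum_of_single {w : ℂ} {a : Fin N} (hN : 2 ≤ N) (f : Fin M → Fin N → ℂ)
    {n : Fin M → Fin N} (h : kinkCount n a + kinkCount n (finRotate N a) = 1) :
    hopSum w a f n = w * ∏ j, f j (bondSwap a (n j)) := by
  obtain ⟨j₀, hj₀⟩ := exists_unique_kink (finRotate_ne hN a).symm h
  rw [hopSum, sum_eq_single j₀]
  · rw [hop, if_pos ((hj₀ j₀).2 rfl), ← mul_prod_erase univ _ (mem_univ j₀)]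
    rw [prod_congr rfl (g := fun i => f i (bondSwap a (n i)))]
    · ring
    · intro i hi
      have := (hj₀ i).not.2 (ne_of_mem_erase hi)
      push Not at this
      rw [bondSwap, Equiv.swap_apply_of_ne_of_ne this.1 this.2]
  · intro k _ hk
    rw [hop, if_neg ((hj₀ k).not.2 hk), mul_zero]
  · simp

lemma hopSum_of_kinkCount_eq_zero {w : ℂ} {a : Fin N} (f : Fin M → Fin N → ℂ)
    {n : Fin M → Fin N} (h1 : kinkCount n a = 0) (h2 : kinkCount n (finRotate N a) = 0) :
    hopSum w a f n = 0 := by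
  refine sum_eq_zero fun k _ => ?_
  rw [hop, if_neg, mul_zero]
  simp only [kinkCount, card_eq_zero, filter_eq_empty_iff, mem_univ, forall_const] at h1 h2
  exact not_or.2 ⟨@h1 k, @h2 k⟩

/-- The independent hops would put both kinks on one site. The result is symmetric in i and j, which
is why it drops out after antisymmetrization. -/
lemma hopSum_of_double {w : ℂ} {a : Fin N} (hN : 2 ≤ N) (f : Fin M → Fin N → ℂ)
    {n : Fin M → Fin N} (hn : Function.Injective n) {i j : Fin M} (hi : n i = a)
    (hj : n j = finRotate N a) :
    hopSum w a f n = w * (∏ l ∈ (univ.erase i).erase j, f l (n l)) *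
      (f i (finRotate N a) * f j (finRotate N a) + f i a * f j a) := by
  have hne := finRotate_ne hN a
  have hij : i ≠ j := by rintro rfl; exact hne (hj.symm.trans hi)
  have h1 : hopSum w a f n = ∑ k ∈ {i, j}, (∏ i ∈ univ.erase k, f i (n i)) * hop w a (f k) (n k) := by
    rw [hopSum]
    refine (sum_subset (subset_univ _) fun k _ hk => ?_).symm
    simp only [mem_insert, mem_singleton, not_or] at hk
    rw [hop, if_neg, mul_zero]
    rintro (h | h)
    · exact hk.1 (hn (h.trans hi.symm))
    · exact hk.2 (hn (h.trans hj.symm))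
  rw [h1, sum_pair hij, ← mul_prod_erase (univ.erase i) _ (show j ∈ univ.erase i by simp [hij.symm]),
    ← mul_prod_erase (univ.erase j) _ (show i ∈ univ.erase j by simp [hij]),
    erase_right_comm (a := j)]
  simp only [hop, hi, hj, true_or, or_true, if_true, bondSwap, Equiv.swap_apply_left,
    Equiv.swap_apply_right]
  ring

/-- Pauli exclusion: `hopSum` lets kinks hop independently, unlike the Hamiltonian. On a doubly
occupied bond, exchanging the ends preserves `hopSum` and the state but reverses `tupleSign`, so the
sum equals its own negative. -/
lemma sum_not_single_hopSum {w : ℂ} (a : Fin N) (hN : 2 ≤ N) (ξ : ℕ) (f : Fin M → Fin N → ℂ) :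
    ∑ n : Fin M → Fin N, (if kinkCount n a + kinkCount n (finRotate N a) = 1 then 0 else
      (tupleSign n * hopSum w a f n)) • kinkState ξ n = 0 := by
  have hne := finRotate_ne hN a
  have key : ∀ n : Fin M → Fin N,
      (if kinkCount (bondSwap a ∘ n) a + kinkCount (bondSwap a ∘ n) (finRotate N a) = 1 then 0 else
        (tupleSign (bondSwap a ∘ n) * hopSum w a f (bondSwap a ∘ n))) •
          kinkState ξ (bondSwap a ∘ n) =
      -((if kinkCount n a + kinkCount n (finRotate N a) = 1 then 0 else
      (tupleSign n * hopSum w a f n)) • kinkState ξ n) := by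
    intro n
    rw [kinkCount_bondSwap_left, kinkCount_bondSwap_right, add_comm (kinkCount n (finRotate N a))]
    split_ifs with h
    · simp
    by_cases hn : Function.Injective n
    · have h1 := kinkCount_le_one hn a
      have h2 := kinkCount_le_one hn (finRotate N a)
      by_cases h0 : kinkCount n a = 0
      · have h3 : kinkCount n (finRotate N a) = 0 := by omega
        rw [hopSum_of_kinkCount_eq_zero f h0 h3, hopSum_of_kinkCount_eq_zero f
          (by rw [kinkCount_bondSwap_left, h3]) (by rw [kinkCount_bondSwap_right, h0])]
        simp
      · obtain ⟨i, hi⟩ := (kinkCount_eq_one_iff hn a).1 (by omega)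
        obtain ⟨j, hj⟩ := (kinkCount_eq_one_iff hn (finRotate N a)).1 (by omega)
        have hij : i ≠ j := by rintro rfl; exact hne (hj.symm.trans hi)
        have e : bondSwap a ∘ n = n ∘ Equiv.swap i j := by
          funext k
          simp only [Function.comp, bondSwap]
          by_cases hk : k = i
          · rw [hk, Equiv.swap_apply_left, hi, hj, Equiv.swap_apply_left]
          · by_cases hk' : k = j
            · rw [hk', Equiv.swap_apply_right, hi, hj, Equiv.swap_apply_right]
            · rw [Equiv.swap_apply_of_ne_of_ne hk hk', Equiv.swap_apply_of_ne_of_ne]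
              · rw [← hi]; exact hn.ne hk
              · rw [← hj]; exact hn.ne hk'
        rw [hopSum_of_double hN f hn hi hj, e, tupleSign_comp_perm, kinkState_comp_perm,
          hopSum_of_double hN f (hn.comp (Equiv.injective _)) (i := j) (j := i) (by simp [hi])
            (by simp [hj]), Equiv.Perm.sign_swap hij, erase_right_comm (a := j),
          prod_congr rfl (g := fun l => f l (n l))]
        · rw [← neg_smul]
          push_cast
          congr 1
          ring
        · intro l hl
          simp only [mem_erase, mem_univ, and_true] at hl
          simp only [Function.comp]
          rw [Equiv.swap_apply_of_ne_of_ne hl.2 hl.1]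
    · rw [tupleSign_eq_zero hn, tupleSign_eq_zero (mt (injective_bondSwap_comp a).1 hn)]
      simp
  have h := sum_bondSwap a fun n : Fin M → Fin N =>
    (if kinkCount n a + kinkCount n (finRotate N a) = 1 then 0 else
      (tupleSign n * hopSum w a f n)) • kinkState ξ n
  simp only [key, sum_neg_distrib] at h
  have h2 := eq_neg_iff_add_eq_zero.1 h.symm
  rw [← two_smul ℂ] at h2
  exact (smul_eq_zero.1 h2).resolve_left two_ne_zero

/-- The amplitude of a hop across a bond. -/
def hopAmplitude (Jx Jy : ℝ) (ξ : ℕ) (a : Fin N) : ℂ :=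
  2 * coupling Jx Jy (finRotate N a) * boundarySign ((-1) ^ (ξ + 1)) a

lemma boundarySign_mul (s t : ℂ) (a : Fin N) :
    boundarySign s a * boundarySign t a = boundarySign (s * t) a := by
  unfold boundarySign
  split_ifs <;> simp

lemma hamiltonian_slaterState (hM : M ≡ N / 2 [MOD 2]) (hN : Even N) (ξ : ℕ) (Jx Jy : ℝ)
    (f : Fin M → Fin N → ℂ) :
    hamiltonian N Jx Jy (slaterState ξ f) = ∑ a, ∑ n : Fin M → Fin N,
      (tupleSign n * hopSum (hopAmplitude Jx Jy ξ a) a f n) • kinkState ξ n := by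
  have h1 : hamiltonian N Jx Jy (slaterState ξ f) = ∑ n : Fin M → Fin N,
      ((tupleSign n : ℂ) * ∏ j, f j (n j)) •
      ∑ a, if kinkCount n a + kinkCount n (finRotate N a) = 1 then
        (2 * coupling Jx Jy (finRotate N a) * boundarySign ((-1) ^ (N / 2 + ξ)) a : ℂ) •
          kinkState ξ (bondSwap a ∘ n) else 0 := by
    rw [slaterState, map_sum]
    refine sum_congr rfl fun n _ => ?_
    rw [map_smul]
    by_cases hn : Function.Injective n
    · rw [hamiltonian_kinkState hM hN ξ hn]
    · rw [tupleSign_eq_zero hn]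
      simp
  rw [h1]
  simp only [smul_sum]
  rw [sum_comm]
  refine sum_congr rfl fun a _ => ?_
  have hN2 : 2 ≤ N := by have := a.2; grind
  have h0 := sum_not_single_hopSum (w := hopAmplitude Jx Jy ξ a) a hN2 ξ f
  -- Indexing by the tuple after the hop lets both sides be compared at the same state.
  rw [← sum_bondSwap a]
  refine sub_eq_zero.1 (Eq.trans ?_ (neg_eq_zero.2 h0))
  rw [← sum_sub_distrib, ← sum_neg_distrib]
  refine sum_congr rfl fun n _ => ?_
  rw [kinkCount_bondSwap_left, kinkCount_bondSwap_right, add_comm (kinkCount n (finRotate N a)),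
    bondSwap_comp_bondSwap]
  split_ifs with h
  · rw [hopSum_of_single hN2 f h, tupleSign_bondSwap hN2 a h]
    -- The truncated `M - 1` has the required parity only for positive M.
    have hMpos : 0 < M := by
      obtain ⟨j₀, _⟩ := exists_unique_kink (finRotate_ne hN2 a).symm h
      exact j₀.pos
    have hs : boundarySign ((-1 : ℂ) ^ (M - 1)) a * boundarySign ((-1) ^ (N / 2 + ξ)) a =
        boundarySign ((-1) ^ (ξ + 1)) a := by
      rw [boundarySign_mul, ← pow_add]
      congr 1
      rw [neg_one_pow_eq_pow_mod_two, neg_one_pow_eq_pow_mod_two (n := ξ + 1)]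
      congr 1
      unfold Nat.ModEq at hM
      omega
    rw [hopAmplitude, ← hs, smul_smul, zero_smul, neg_zero, ← sub_smul]
    convert zero_smul ℂ _ using 2
    simp only [Function.comp]
    ring
  · simp

lemma hamiltonian_slaterState_of_eigen (hM : M ≡ N / 2 [MOD 2]) (hN : Even N) (ξ : ℕ) (Jx Jy : ℝ)
    (f : Fin M → Fin N → ℂ) (E : Fin M → ℂ)
    (hf : ∀ j x, ∑ a, hop (hopAmplitude Jx Jy ξ a) a (f j) x = E j * f j x) :
    hamiltonian N Jx Jy (slaterState ξ f) = (∑ j, E j) • slaterState ξ f := by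
  rw [hamiltonian_slaterState hM hN, sum_comm, slaterState, smul_sum]
  refine sum_congr rfl fun n _ => ?_
  rw [← sum_smul, smul_smul]
  congr 1
  simp only [hopSum, ← mul_sum]
  rw [sum_comm]
  simp only [← mul_sum, hf]
  rw [mul_left_comm, sum_mul]
  congr 1
  refine sum_congr rfl fun k _ => ?_
  rw [← mul_prod_erase univ _ (mem_univ k)]
  ring

/-- Bonds are labelled by their left end, so for N = 2 the two bonds between the same sites still
count separately. -/
lemma sum_hop (hN : 2 ≤ N) (w : Fin N → ℂ) (f : Fin N → ℂ) (x : Fin N) :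
    ∑ a, hop (w a) a f x = w x * f (finRotate N x) +
      w ((finRotate N).symm x) * f ((finRotate N).symm x) := by
  have h1 := finRotate_ne hN x
  have h2 : (finRotate N).symm x ≠ x := by
    intro h
    exact h1 (by conv_lhs => rw [← h, Equiv.apply_symm_apply])
  rw [← sum_subset (subset_univ {x, (finRotate N).symm x}), sum_pair h2.symm]
  · simp only [hop, bondSwap, true_or, if_true, Equiv.swap_apply_left, Equiv.apply_symm_apply,
      or_true, Equiv.swap_apply_right]
  · intro a _ ha
    simp only [mem_insert, mem_singleton, not_or] at ha
    rw [hop, if_neg]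
    rintro (h | h)
    · exact ha.1 h.symm
    · exact ha.2 (by rw [h, Equiv.symm_apply_apply])

/-! ### The one-kink eigenvalue problem -/

lemma sin_eq_of_cos_eq_zero {p : ℝ} (hp : p ∈ Set.Ioc (-(Real.pi / 2)) (3 * Real.pi / 2))
    (h : Real.cos p = 0) : Real.sin p = if p ≤ Real.pi / 2 then 1 else -1 := by
  have hpi := Real.pi_pos
  split_ifs with h1
  · have : p = Real.pi / 2 := by
      by_contra hne
      have := Real.cos_pos_of_mem_Ioo ⟨hp.1, lt_of_le_of_ne h1 hne⟩
      linarith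
    rw [this, Real.sin_pi_div_two]
  · have : p = Real.pi / 2 + Real.pi := by
      by_contra hne
      have := Real.cos_neg_of_pi_div_two_lt_of_lt (x := p) (by linarith)
        (lt_of_le_of_ne (by linarith [hp.2]) hne |>.trans_eq (add_comm _ _))
      linarith
    rw [this, Real.sin_add_pi, Real.sin_pi_div_two]

lemma sign_mul_cos_nonneg {p : ℝ} (hp : p ∈ Set.Ioc (-(Real.pi / 2)) (3 * Real.pi / 2)) :
    0 ≤ (if p ≤ Real.pi / 2 then 1 else -1) * Real.cos p := by
  split_ifs with h1
  · rw [one_mul]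
    exact Real.cos_nonneg_of_mem_Icc ⟨hp.1.le, h1⟩
  · have := Real.cos_nonpos_of_pi_div_two_le_of_le (x := p) (by linarith) (by linarith [hp.2])
    linarith

/-- These are the real and imaginary parts of E e^{2iφ} = 2(J_x e^{ip} + J_y e^{-ip}). The squared
modulus is E² because J_x J_y = 1; as 2φ lies in [-π/2, π/2], E carries the sign of cos p. At cos p
= 0 the sign of sin p takes over, which fits the limit from the left. -/
lemma kinkEnergy_mul_phase {Jx Jy : ℝ} (hJx : 0 < Jx) (hJy : 0 < Jy) (hJ : Jx * Jy = 1) {p : ℝ}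
    (hp : p ∈ Set.Ioc (-(Real.pi / 2)) (3 * Real.pi / 2)) :
    kinkEnergy Jx Jy p * Real.cos (2 * phase Jx Jy p) = 2 * (Jx + Jy) * Real.cos p ∧
      kinkEnergy Jx Jy p * Real.sin (2 * phase Jx Jy p) = 2 * (Jx - Jy) * Real.sin p := by
  have hs := sign_mul_cos_nonneg hp
  have hε : ((if p ≤ Real.pi / 2 then 1 else -1 : ℝ)) * (if p ≤ Real.pi / 2 then 1 else -1) = 1 := by
    split_ifs <;> norm_num
  have hsin := sin_eq_of_cos_eq_zero hp
  unfold kinkEnergy phase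
  set ε : ℝ := if p ≤ Real.pi / 2 then 1 else -1
  split_ifs with h
  · rw [hsin h, h]
    have hD : Real.sqrt (4 * (0 : ℝ) ^ 2 + (Jx - Jy) ^ 2) = |Jx - Jy| := by
      rw [← Real.sqrt_sq_eq_abs]; congr 1; ring
    rw [hD]
    rcases lt_trichotomy (Jx - Jy) 0 with h1 | h1 | h1
    · rw [sign_neg h1, abs_of_neg h1, show 2 * (((-1 : SignType) : ℝ) * (Real.pi / 4)) =
        -(Real.pi / 2) by simp; ring, Real.cos_neg, Real.sin_neg, Real.cos_pi_div_two,
        Real.sin_pi_div_two]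
      constructor <;> ring
    -- For J_x = J_y the energy vanishes here, and both equations are trivial.
    · rw [h1]
      simp
    · rw [sign_pos h1, abs_of_pos h1, show 2 * (((1 : SignType) : ℝ) * (Real.pi / 4)) =
        Real.pi / 2 by simp; ring, Real.cos_pi_div_two, Real.sin_pi_div_two]
      constructor <;> ring
  · set t := (Jx - Jy) / (Jx + Jy) * Real.tan p with ht
    rw [show 2 * (1 / 2 * Real.arctan t) = Real.arctan t by ring]
    have hc : 0 < Real.cos (Real.arctan t) := Real.cos_arctan_pos t
    have htan : Real.sin (Real.arctan t) = t * Real.cos (Real.arctan t) := by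
      have := Real.tan_arctan t
      rw [Real.tan_eq_sin_div_cos] at this
      exact (div_eq_iff hc.ne').1 this
    have hct : Real.cos (Real.arctan t) ^ 2 * (1 + t ^ 2) = 1 := by
      have := Real.sin_sq_add_cos_sq (Real.arctan t)
      rw [htan] at this
      linear_combination this
    set c := Real.cos (Real.arctan t)
    have hD0 : 0 ≤ 4 * Real.cos p ^ 2 + (Jx - Jy) ^ 2 := by positivity
    have hD1 := Real.sq_sqrt hD0
    set D := Real.sqrt (4 * Real.cos p ^ 2 + (Jx - Jy) ^ 2)
    have htc : t * ((Jx + Jy) * Real.cos p) = (Jx - Jy) * Real.sin p := by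
      rw [ht, Real.tan_eq_sin_div_cos]
      field_simp
    have hD2 : D ^ 2 = (1 + t ^ 2) * ((Jx + Jy) * Real.cos p) ^ 2 := by
      have h1 : (1 + t ^ 2) * ((Jx + Jy) * Real.cos p) ^ 2 =
        ((Jx + Jy) * Real.cos p) ^ 2 + (t * ((Jx + Jy) * Real.cos p)) ^ 2 := by ring
      rw [h1, htc, hD1]
      have h2 := Real.sin_sq_add_cos_sq p
      linear_combination (-(Jx - Jy) ^ 2) * h2 - 4 * Real.cos p ^ 2 * hJ
    -- Both sides are nonnegative on the Brillouin zone and have equal squares.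
    have hmain : ε * ((Jx + Jy) * Real.cos p) = D * c := by
      refine (sq_eq_sq₀ ?_ ?_).1 ?_
      · have : ε * ((Jx + Jy) * Real.cos p) = (Jx + Jy) * (ε * Real.cos p) := by ring
        rw [this]
        positivity
      · exact mul_nonneg (Real.sqrt_nonneg _) hc.le
      · rw [mul_pow ε, mul_pow D, hD2]
        linear_combination (((Jx + Jy) * Real.cos p) ^ 2) * hε - ((Jx + Jy) * Real.cos p) ^ 2 * hct
    constructor
    · linear_combination (-2 * ε) * hmain + 2 * ((Jx + Jy) * Real.cos p) * hε
    · rw [htan]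
      linear_combination (-2 * ε * t) * hmain + 2 * t * ((Jx + Jy) * Real.cos p) * hε + 2 * htc

lemma amplitude_eq (Jx Jy : ℝ) (n : ℕ) (p : ℝ) :
    amplitude Jx Jy n p = exp (I * p) ^ n * exp (-((-1) ^ n * (I * phase Jx Jy p))) := by
  rw [amplitude, ← Complex.exp_nat_mul, ← Complex.exp_add]
  congr 1
  push_cast
  ring

lemma kinkEnergy_exp {Jx Jy : ℝ} (hJx : 0 < Jx) (hJy : 0 < Jy) (hJ : Jx * Jy = 1) {p : ℝ}
    (hp : p ∈ Set.Ioc (-(Real.pi / 2)) (3 * Real.pi / 2)) :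
    2 * (Jx * exp (I * p) + Jy * exp (-(I * p))) =
        (kinkEnergy Jx Jy p : ℂ) * exp (I * phase Jx Jy p) ^ 2 ∧
      2 * (Jy * exp (I * p) + Jx * exp (-(I * p))) =
        (kinkEnergy Jx Jy p : ℂ) * exp (-(I * phase Jx Jy p)) ^ 2 := by
  obtain ⟨h1, h2⟩ := kinkEnergy_mul_phase hJx hJy hJ hp
  have e : ∀ x : ℝ, exp (I * x) = (Real.cos x : ℂ) + I * (Real.sin x : ℂ) := by
    intro x
    rw [mul_comm, exp_mul_I]
    push_cast
    ring
  have e' : ∀ x : ℝ, exp (-(I * x)) = (Real.cos x : ℂ) - I * (Real.sin x : ℂ) := by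
    intro x
    have := e (-x)
    rw [Real.cos_neg, Real.sin_neg] at this
    push_cast at this ⊢
    rw [← mul_neg, this]
    ring
  have e2 : exp (I * phase Jx Jy p) ^ 2 = exp (I * ((2 * phase Jx Jy p : ℝ) : ℂ)) := by
    rw [← Complex.exp_nat_mul]
    congr 1
    push_cast
    ring
  have e3 : exp (-(I * phase Jx Jy p)) ^ 2 = exp (-(I * ((2 * phase Jx Jy p : ℝ) : ℂ))) := by
    rw [← Complex.exp_nat_mul]
    congr 1
    push_cast
    ring
  have h1' : (kinkEnergy Jx Jy p : ℂ) * (Real.cos (2 * phase Jx Jy p) : ℂ) =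
      2 * (Jx + Jy) * (Real.cos p : ℂ) := by exact_mod_cast h1
  have h2' : (kinkEnergy Jx Jy p : ℂ) * (Real.sin (2 * phase Jx Jy p) : ℂ) =
      2 * (Jx - Jy) * (Real.sin p : ℂ) := by exact_mod_cast h2
  rw [e2, e3, e, e', e, e']
  constructor
  · linear_combination -h1' - I * h2'
  · linear_combination -h1' + I * h2'

/-- The staggered sign of φ gives neighbouring positions opposite phases, so the relation for E
e^{2iφ} serves one parity of n and its conjugate the other. -/
lemma amplitude_recurrence {Jx Jy : ℝ} (hJx : 0 < Jx) (hJy : 0 < Jy) (hJ : Jx * Jy = 1) {p : ℝ}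
    (hp : p ∈ Set.Ioc (-(Real.pi / 2)) (3 * Real.pi / 2)) (n : ℕ) :
    2 * ((if Odd (n + 1) then Jx else Jy : ℝ) : ℂ) * amplitude Jx Jy (n + 2) p +
      2 * ((if Odd n then Jx else Jy : ℝ) : ℂ) * amplitude Jx Jy n p =
      kinkEnergy Jx Jy p * amplitude Jx Jy (n + 1) p := by
  obtain ⟨h1, h2⟩ := kinkEnergy_exp hJx hJy hJ hp
  simp only [amplitude_eq]
  have hz : exp (I * p) * exp (-(I * p)) = 1 := by rw [← Complex.exp_add]; simp
  have hy : exp (I * phase Jx Jy p) * exp (-(I * phase Jx Jy p)) = 1 := by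
    rw [← Complex.exp_add]; simp
  set z := exp (I * p)
  set z' := exp (-(I * p))
  rcases Nat.even_or_odd n with hn | hn
  · have hn' : ¬ Odd n := by simpa using hn
    have e0 : (-1 : ℂ) ^ n = 1 := hn.neg_one_pow
    have e1 : (-1 : ℂ) ^ (n + 1) = -1 := by rw [pow_succ, e0]; ring
    have e2 : (-1 : ℂ) ^ (n + 2) = 1 := by rw [pow_succ, e1]; ring
    rw [if_pos hn.add_one, if_neg hn', e0, e1, e2, one_mul, neg_one_mul, neg_neg]
    set y := exp (I * phase Jx Jy p)
    set y' := exp (-(I * phase Jx Jy p))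
    linear_combination (z ^ (n + 1) * y') * h1 - 2 * Jy * z ^ n * y' * hz +
      kinkEnergy Jx Jy p * z ^ (n + 1) * y * hy
  · have hn' : ¬ Odd (n + 1) := by simpa using hn.add_one
    have e0 : (-1 : ℂ) ^ n = -1 := hn.neg_one_pow
    have e1 : (-1 : ℂ) ^ (n + 1) = 1 := by rw [pow_succ, e0]; ring
    have e2 : (-1 : ℂ) ^ (n + 2) = -1 := by rw [pow_succ, e1]; ring
    rw [if_pos hn, if_neg hn', e0, e1, e2, one_mul, neg_one_mul, neg_neg]
    set y := exp (I * phase Jx Jy p)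
    set y' := exp (-(I * phase Jx Jy p))
    linear_combination (z ^ (n + 1) * y) * h2 - 2 * Jx * z ^ n * y * hz +
      kinkEnergy Jx Jy p * z ^ (n + 1) * y' * hy

/-- Since N is even, a turn around the ring preserves the staggering (-1)^n and only e^{iNp}
remains. -/
lemma amplitude_add_period (hN : Even N) (Jx Jy : ℝ) {ξ : ℕ} {p : ℝ}
    (hp : exp (I * N * p) = (-1) ^ (ξ + 1)) (n : ℕ) :
    amplitude Jx Jy (n + N) p = (-1) ^ (ξ + 1) * amplitude Jx Jy n p := by
  rw [amplitude_eq, amplitude_eq, ← hp, pow_add, pow_add, hN.neg_one_pow, ← Complex.exp_nat_mul,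
    ← Complex.exp_nat_mul, mul_one, show (N : ℂ) * (I * p) = I * N * p by ring]
  ring

lemma sum_hop_amplitude (hN : Even N) {Jx Jy : ℝ} (hJx : 0 < Jx) (hJy : 0 < Jy)
    (hJ : Jx * Jy = 1) {ξ : ℕ} {p : ℝ} (hp : p ∈ Set.Ioc (-(Real.pi / 2)) (3 * Real.pi / 2))
    (hpN : exp (I * N * p) = (-1) ^ (ξ + 1)) (x : Fin N) :
    ∑ a, hop (hopAmplitude Jx Jy ξ a) a (fun x => amplitude Jx Jy (pos x) p) x =
      kinkEnergy Jx Jy p * amplitude Jx Jy (pos x) p := by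
  have hN2 : 2 ≤ N := by have := x.2; grind
  rw [sum_hop hN2, show pos x = (x : ℕ) + 1 from rfl, ← amplitude_recurrence hJx hJy hJ hp]
  have hper := amplitude_add_period hN Jx Jy hpN
  congr 1
  · have hr := coe_finRotate_eq x
    have hpar : Odd ((finRotate N x : Fin N) : ℕ) ↔ Odd ((x : ℕ) + 1) := by
      rw [odd_coe_finRotate hN, Nat.odd_add_one]
    simp only [hopAmplitude, coupling, hpar, boundarySign, pos]
    rw [mul_assoc]
    congr 1
    split_ifs at hr ⊢ with h
    · rw [hr, ← hper]
      congr 1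
      omega
    · rw [hr, one_mul]
  · set y := (finRotate N).symm x with hy
    have hxy : finRotate N y = x := by rw [hy, Equiv.apply_symm_apply]
    have hr := coe_finRotate_eq y
    rw [hxy] at hr
    simp only [hopAmplitude, coupling, boundarySign, pos, hxy]
    rw [mul_assoc]
    congr 1
    split_ifs at hr ⊢ with h
    · have h0 := hper 0
      rw [hr, h, show N = 0 + N by omega, h0, ← mul_assoc, ← mul_pow]
      simp
    · rw [hr, one_mul]

lemma hamiltonian_bethe (hN : Even N) {Jx Jy : ℝ} (hJx : 0 < Jx) (hJy : 0 < Jy)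
    (hJ : Jx * Jy = 1) (a : Label N) :
    hamiltonian N Jx Jy (a.state Jx Jy) = ((a.energy Jx Jy : ℝ) : ℂ) • a.state Jx Jy := by
  rw [Label.state, bethe_eq, map_smul,
    hamiltonian_slaterState_of_eigen a.parity hN _ Jx Jy _ (fun j => (kinkEnergy Jx Jy (a.p j) : ℂ))
      (fun j x => sum_hop_amplitude hN hJx hJy hJ (a.p_mem j) (a.p_bethe j) x), smul_comm,
    Label.energy]
  push_cast
  rfl

/-! ### Gram matrix of the one-kink amplitudes -/

lemma phase_add_pi (Jx Jy p : ℝ) : phase Jx Jy (p + Real.pi) = phase Jx Jy p := by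
  simp only [phase, Real.cos_add_pi, neg_eq_zero, Real.tan_add_pi]

lemma star_amplitude_mul (Jx Jy : ℝ) (n : ℕ) (p p' : ℝ) :
    star (amplitude Jx Jy n p) * amplitude Jx Jy n p' =
      exp (I * (p' - p)) ^ n * exp (-((-1) ^ n * (I * (phase Jx Jy p' - phase Jx Jy p)))) := by
  have h : star (amplitude Jx Jy n p) =
      exp (-(I * ((n * p - (-1) ^ n * phase Jx Jy p : ℝ) : ℂ))) := by
    rw [amplitude, star_def, ← exp_conj, map_mul, conj_I, conj_ofReal, neg_mul]
  rw [h, amplitude, ← Complex.exp_nat_mul, ← Complex.exp_add, ← Complex.exp_add]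
  congr 1
  push_cast
  ring

lemma sum_range_two_mul {V : Type*} [AddCommMonoid V] (g : ℕ → V) (K : ℕ) :
    ∑ k ∈ range (2 * K), g k = ∑ k ∈ range K, (g (2 * k) + g (2 * k + 1)) := by
  induction K with
  | zero => simp
  | succ K ih => rw [mul_add, mul_one, sum_range_succ, sum_range_succ, ih, sum_range_succ, add_assoc]

/-- Splitting by the parity of the position leaves a geometric sum in z² with z = e^{i(p'-p)}, which
vanishes unless z² = 1. If z = -1, then p and p' differ by π, where φ agrees, and the two
sublattices cancel. -/
lemma sum_star_amplitude_mul (hN : Even N) (Jx Jy : ℝ) {ξ : ℕ} {p p' : ℝ}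
    (hp : p ∈ Set.Ioc (-(Real.pi / 2)) (3 * Real.pi / 2))
    (hp' : p' ∈ Set.Ioc (-(Real.pi / 2)) (3 * Real.pi / 2))
    (hpN : exp (I * N * p) = (-1) ^ (ξ + 1)) (hpN' : exp (I * N * p') = (-1) ^ (ξ + 1)) :
    ∑ x : Fin N, star (amplitude Jx Jy (pos x) p) * amplitude Jx Jy (pos x) p' =
      if p = p' then (N : ℂ) else 0 := by
  simp only [star_amplitude_mul]
  split_ifs with h
  · subst h
    simp
  have hpi := Real.pi_pos
  obtain ⟨K, hK⟩ := hN
  rw [← two_mul] at hK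
  set z := exp (I * (p' - p)) with hz
  set y := exp (I * (phase Jx Jy p' - phase Jx Jy p)) with hy
  set y' := exp (-(I * (phase Jx Jy p' - phase Jx Jy p))) with hy'
  have hzN : (z ^ 2) ^ K = 1 := by
    rw [← pow_mul, ← hK, hz, ← Complex.exp_nat_mul,
      show (N : ℂ) * (I * (p' - p)) = I * N * p' - I * N * p by ring, Complex.exp_sub, hpN, hpN']
    exact div_self (by simp)
  have h1 : ∑ x : Fin N, z ^ pos x * exp (-((-1) ^ pos x * (I * (phase Jx Jy p' - phase Jx Jy p)))) =
      (∑ k ∈ range K, (z ^ 2) ^ k) * (z * y + z ^ 2 * y') := by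
    have h2 := Fin.sum_univ_eq_sum_range (fun k => z ^ (k + 1) *
      exp (-((-1) ^ (k + 1) * (I * (phase Jx Jy p' - phase Jx Jy p))))) N
    simp only [pos]
    rw [h2, hK, sum_range_two_mul, sum_mul]
    refine sum_congr rfl fun k _ => ?_
    have e1 : (-1 : ℂ) ^ (2 * k + 1) = -1 := (odd_two_mul_add_one k).neg_one_pow
    have e2 : (-1 : ℂ) ^ (2 * k + 1 + 1) = 1 := by rw [pow_succ, e1]; ring
    rw [e1, e2, neg_one_mul, neg_neg, one_mul]
    ring
  rw [h1]
  by_cases hz2 : z ^ 2 = 1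
  · have hint : ∀ r : ℝ, z = exp (r * I) → ∃ n : ℤ, p' - p = r + n * (2 * Real.pi) := by
      intro r hr
      obtain ⟨n, hn⟩ := Complex.exp_eq_exp_iff_exists_int.1 (hz.symm.trans hr)
      refine ⟨n, ?_⟩
      have h2 : ((p' - p : ℝ) : ℂ) = ((r + n * (2 * Real.pi) : ℝ) : ℂ) := by
        refine mul_left_cancel₀ I_ne_zero ?_
        push_cast
        rw [hn]
        ring
      exact_mod_cast h2
    have hlt : p' - p < 2 * Real.pi := by linarith [hp.1, hp'.2]
    have hgt : -(2 * Real.pi) < p' - p := by linarith [hp.2, hp'.1]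
    rcases sq_eq_one_iff.1 hz2 with hz1 | hz1
    · obtain ⟨n, hn⟩ := hint 0 (by simp [hz1])
      rw [hn] at hlt hgt
      have h3 : (n : ℝ) < 1 := by nlinarith
      have h4 : (-1 : ℝ) < n := by nlinarith
      have h5 : n < 1 := by exact_mod_cast h3
      have h6 : -1 < n := by exact_mod_cast h4
      have h7 : n = 0 := by omega
      rw [h7] at hn
      exact absurd (by push_cast at hn; linarith) h
    · obtain ⟨n, hn⟩ := hint Real.pi (by rw [hz1, exp_pi_mul_I])
      rw [hn] at hlt hgt
      have h3 : (n : ℝ) < 1 := by nlinarith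
      have h4 : (-2 : ℝ) < n := by nlinarith
      have h5 : n < 1 := by exact_mod_cast h3
      have h6 : -2 < n := by exact_mod_cast h4
      have hphase : phase Jx Jy p' = phase Jx Jy p := by
        have h7 : n = 0 ∨ n = -1 := by omega
        rcases h7 with h7 | h7 <;> rw [h7] at hn <;> push_cast at hn
        · rw [← phase_add_pi Jx Jy p]
          congr 1
          linarith
        · rw [← phase_add_pi Jx Jy p']
          congr 1
          linarith
      rw [hy, hy', hz1, hphase]
      simp
  · have := geom_sum_mul (z ^ 2) K
    rw [hzN, sub_self] at this
    rw [(mul_eq_zero.1 this).resolve_right (sub_ne_zero.2 hz2), zero_mul]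

/-- The Cauchy–Binet formula, for the sum over the strictly increasing selections of rows. -/
lemma sum_star_det_mul_det (f g : Fin M → Fin N → ℂ) :
    ∑ s ∈ univ.filter (fun n : Fin M → Fin N => StrictMono n),
      star (Matrix.of fun j l : Fin M => f l (s j)).det *
        (Matrix.of fun j l : Fin M => g l (s j)).det =
      (Matrix.of fun i j : Fin M => ∑ x, star (f i x) * g j x).det := by
  -- The conjugated determinant is antisymmetric in the rows, so the expansion over all tuples folds
  -- onto the increasing ones.
  set D : (Fin M → Fin N) → ℂ := fun n => star (Matrix.of fun j l : Fin M => f l (n j)).det with hD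
  have hD1 : ∀ n, D n = ∑ σ : Equiv.Perm (Fin M), (Equiv.Perm.sign σ : ℂ) *
      ∏ i, star (f (σ i) (n i)) := by
    intro n
    simp only [hD]
    rw [← Matrix.det_transpose, Matrix.det_apply', star_sum]
    refine sum_congr rfl fun σ _ => ?_
    rw [star_mul', star_prod]
    simp
  have hD2 : ∀ (n : Fin M → Fin N) (σ : Equiv.Perm (Fin M)),
      D (n ∘ σ) = Equiv.Perm.sign σ * D n := by
    intro n σ
    have h := Matrix.det_permute σ (Matrix.of fun j l : Fin M => f l (n j))
    have h2 : (Matrix.of fun j l : Fin M => f l ((n ∘ σ) j)) =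
        (Matrix.of fun j l : Fin M => f l (n j)).submatrix σ id := rfl
    simp only [hD]
    rw [h2, h, star_mul']
    simp
  have hD3 : ∀ n, ¬ Function.Injective n → D n = 0 := by
    intro n hn
    simp only [Function.Injective, not_forall] at hn
    obtain ⟨i, j, h, hij⟩ := hn
    simp only [hD]
    rw [Matrix.det_zero_of_row_eq hij, star_zero]
    funext l
    simp [h]
  have h1 : (Matrix.of fun i j : Fin M => ∑ x, star (f i x) * g j x).det =
      ∑ n : Fin M → Fin N, D n * ∏ i, g i (n i) := by
    rw [Matrix.det_apply']
    simp only [Matrix.of_apply, prod_univ_sum, Fintype.piFinset_univ, prod_mul_distrib, hD1, sum_mul,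
      mul_sum]
    rw [sum_comm]
    simp only [mul_assoc]
  rw [h1, sum_eq_sum_strictMono]
  · refine sum_congr rfl fun s _ => ?_
    rw [Matrix.det_apply' (Matrix.of fun j l : Fin M => g l (s j)), mul_sum]
    refine sum_congr rfl fun σ _ => ?_
    rw [hD2]
    simp only [hD, Matrix.of_apply, Function.comp]
    ring
  · intro n hn
    rw [hD3 n hn, zero_mul]

/-! ### Inner products of the states -/

lemma inner_productState (v w : Fin N → Fin 2 → ℂ) :
    inner ℂ (productState v) (productState w) = ∏ l, ∑ b, star (v l b) * w l b := by
  rw [prod_univ_sum, Fintype.piFinset_univ, PiLp.inner_apply]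
  refine sum_congr rfl fun s _ => ?_
  simp only [productState, RCLike.inner_apply, map_prod, prod_mul_distrib, star_def]
  ring

lemma sum_star_qubit_mul (u v : ℤ) :
    ∑ b, star (qubit u b) * qubit v b = (1 + I ^ (v - u)) / 2 := by
  have h2 : ((Real.sqrt 2 : ℝ) : ℂ) * (Real.sqrt 2 : ℝ) = 2 := by
    rw [← ofReal_mul, Real.mul_self_sqrt (by norm_num)]
    norm_num
  have h0 : ((Real.sqrt 2 : ℝ) : ℂ) ≠ 0 := by
    intro h
    rw [h] at h2
    norm_num at h2
  have h3 : star ((I : ℂ) ^ u) = I ^ (-u) := by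
    rw [star_zpow₀, star_def, conj_I, zpow_neg, ← inv_zpow, inv_I]
  rw [Fin.sum_univ_two]
  simp only [qubit, Matrix.cons_val_zero, Matrix.cons_val_one, star_div₀, star_one, h3]
  rw [sub_eq_neg_add, zpow_add₀ I_ne_zero, ← h2]
  have h4 : star ((Real.sqrt 2 : ℝ) : ℂ) = (Real.sqrt 2 : ℝ) := conj_ofReal _
  rw [h4]
  field_simp

lemma inner_spinState_self (u : Fin N → ℤ) : inner ℂ (spinState u) (spinState u) = (1 : ℂ) := by
  rw [spinState, inner_productState]
  refine prod_eq_one fun l _ => ?_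
  rw [sum_star_qubit_mul]
  simp

lemma inner_spinState_eq_zero {u v : Fin N → ℤ} {l : Fin N} (h : (v l - u l) % 4 = 2) :
    inner ℂ (spinState u) (spinState v) = (0 : ℂ) := by
  rw [spinState, spinState, inner_productState]
  refine prod_eq_zero (mem_univ l) ?_
  rw [sum_star_qubit_mul, I_zpow_congr (v := ((2 : ℕ) : ℤ)) (by push_cast; omega), zpow_natCast,
    I_sq]
  simp

lemma inner_chiralState_self (κ : ℤ) (n : Fin M → Fin N) :
    inner ℂ (chiralState κ n) (chiralState κ n) = (1 : ℂ) := by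
  rw [chiralState_eq, inner_smul_left, inner_smul_right, inner_spinState_self, mul_one, map_pow,
    ← mul_pow, map_neg, conj_I, neg_neg, mul_neg, I_mul_I, neg_neg, one_pow]

/-- Angles of equal parity are congruent modulo 4 or give orthogonal qubits. If they are congruent
at every site, κ is recovered from the first site and the kinks from the increments. -/
lemma inner_chiralState_eq_zero {M' : ℕ} (hN : Even N) (hN0 : 0 < N) (hM : M ≡ N / 2 [MOD 2])
    (hM' : M' ≡ N / 2 [MOD 2]) {κ κ' : ℤ} (hκ : κ = 1 ∨ κ = -1) (hκ' : κ' = 1 ∨ κ' = -1)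
    {n : Fin M → Fin N} {n' : Fin M' → Fin N} (hn : Function.Injective n)
    (hn' : Function.Injective n') (h : κ ≠ κ' ∨ Set.range n ≠ Set.range n') :
    inner ℂ (chiralState κ n) (chiralState κ' n') = (0 : ℂ) := by
  rw [chiralState_eq, chiralState_eq, inner_smul_left, inner_smul_right]
  suffices h1 : ∃ l, (config κ' n' l - config κ n l) % 4 = 2 by
    obtain ⟨l, hl⟩ := h1
    rw [inner_spinState_eq_zero hl]
    simp
  by_contra hcon
  push Not at hcon
  have hall : ∀ l, 4 ∣ config κ' n' l - config κ n l := by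
    intro l
    have h1 := two_dvd_config hκ n l
    have h2 := two_dvd_config hκ' n' l
    have h3 := hcon l
    omega
  rcases h with h | h
  · have h1 := hall ⟨0, hN0⟩
    have e : ∀ {M : ℕ} (n : Fin M → Fin N), (univ.filter fun j => n j < ⟨0, hN0⟩) = ∅ := by
      intro M n
      rw [filter_eq_empty_iff]
      intro j _ hj
      exact Nat.not_lt_zero _ (Fin.lt_def.1 hj)
    simp only [config, e, card_empty] at h1
    rcases hκ with rfl | rfl <;> rcases hκ' with rfl | rfl <;> omega
  · apply h
    ext x
    rw [← kinkCount_eq_one_iff hn, ← kinkCount_eq_one_iff hn']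
    have h1 := config_finRotate hM hN κ n x
    have h2 := config_finRotate hM' hN κ' n' x
    have h3 := hall x
    have h4 := hall (finRotate N x)
    have h5 := kinkCount_le_one hn x
    have h6 := kinkCount_le_one hn' x
    omega

lemma inner_kinkState_self (hN : Even N) (hN0 : 0 < N) (hM : M ≡ N / 2 [MOD 2]) (ξ ξ' : Fin 2)
    {n : Fin M → Fin N} (hn : Function.Injective n) :
    inner ℂ (kinkState (ξ : ℕ) n) (kinkState (ξ' : ℕ) n) = if ξ = ξ' then (2 : ℂ) else 0 := by
  simp only [kinkState, sum_pair (show (1 : ℤ) ≠ -1 by decide), inner_add_left, inner_add_right,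
    inner_smul_left, inner_smul_right, inner_chiralState_self]
  rw [inner_chiralState_eq_zero hN hN0 hM hM (Or.inl rfl) (Or.inr rfl) hn hn (Or.inl (by decide)),
    inner_chiralState_eq_zero hN hN0 hM hM (Or.inr rfl) (Or.inl rfl) hn hn (Or.inl (by decide))]
  fin_cases ξ <;> fin_cases ξ' <;> norm_num

lemma inner_kinkState_eq_zero {M' : ℕ} (hN : Even N) (hN0 : 0 < N) (hM : M ≡ N / 2 [MOD 2])
    (hM' : M' ≡ N / 2 [MOD 2]) (ξ ξ' : ℕ) {n : Fin M → Fin N} {n' : Fin M' → Fin N}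
    (hn : Function.Injective n) (hn' : Function.Injective n') (h : Set.range n ≠ Set.range n') :
    inner ℂ (kinkState ξ n) (kinkState ξ' n') = (0 : ℂ) := by
  simp only [kinkState, sum_pair (show (1 : ℤ) ≠ -1 by decide), inner_add_left, inner_add_right,
    inner_smul_left, inner_smul_right]
  rw [inner_chiralState_eq_zero hN hN0 hM hM' (Or.inl rfl) (Or.inl rfl) hn hn' (Or.inr h),
    inner_chiralState_eq_zero hN hN0 hM hM' (Or.inl rfl) (Or.inr rfl) hn hn' (Or.inr h),
    inner_chiralState_eq_zero hN hN0 hM hM' (Or.inr rfl) (Or.inl rfl) hn hn' (Or.inr h),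
    inner_chiralState_eq_zero hN hN0 hM hM' (Or.inr rfl) (Or.inr rfl) hn hn' (Or.inr h)]
  simp

/-- The kink states of increasing tuples are orthogonal with squared norm 2, so the pairing is a
Cauchy–Binet sum. -/
lemma inner_slaterState (hN : Even N) (hN0 : 0 < N) (hM : M ≡ N / 2 [MOD 2]) (ξ ξ' : Fin 2)
    (f g : Fin M → Fin N → ℂ) :
    inner ℂ (slaterState (ξ : ℕ) f) (slaterState (ξ' : ℕ) g) =
      (if ξ = ξ' then (2 : ℂ) else 0) *
        (Matrix.of fun i j : Fin M => ∑ x, star (f i x) * g j x).det := by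
  rw [slaterState_eq, slaterState_eq, sum_inner, ← sum_star_det_mul_det, mul_sum]
  refine sum_congr rfl fun s hs => ?_
  have hs' := (mem_filter.1 hs).2
  rw [inner_sum, sum_eq_single s]
  · rw [inner_smul_left, inner_smul_right, inner_kinkState_self hN hN0 hM ξ ξ' hs'.injective,
      star_def]
    ring
  · intro t ht hts
    have ht' := (mem_filter.1 ht).2
    rw [inner_smul_left, inner_smul_right, inner_kinkState_eq_zero hN hN0 hM hM _ _ hs'.injective
      ht'.injective]
    · simp
    · intro h
      exact hts ((StrictMono.range_inj ht' hs').1 h.symm)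
  · exact fun h => absurd hs h

lemma inner_slaterState_eq_zero {M' : ℕ} (hN : Even N) (hN0 : 0 < N) (hM : M ≡ N / 2 [MOD 2])
    (hM' : M' ≡ N / 2 [MOD 2]) (hMM : M ≠ M') (ξ ξ' : ℕ)
    (f : Fin M → Fin N → ℂ) (g : Fin M' → Fin N → ℂ) :
    inner ℂ (slaterState ξ f) (slaterState ξ' g) = (0 : ℂ) := by
  rw [slaterState_eq, slaterState_eq, sum_inner]
  refine sum_eq_zero fun s hs => ?_
  rw [inner_sum]
  refine sum_eq_zero fun t ht => ?_
  have hs' := (mem_filter.1 hs).2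
  have ht' := (mem_filter.1 ht).2
  rw [inner_smul_left, inner_smul_right, inner_kinkState_eq_zero hN hN0 hM hM' _ _ hs'.injective
    ht'.injective]
  · simp
  · intro h
    apply hMM
    have h1 := Set.ncard_range_of_injective hs'.injective
    have h2 := Set.ncard_range_of_injective ht'.injective
    rw [h, h2] at h1
    simpa using h1.symm

lemma orthonormal_state (hN : Even N) (hN0 : 0 < N) (Jx Jy : ℝ) :
    Orthonormal ℂ (fun a : Label N => a.state Jx Jy) := by
  classical
  rw [orthonormal_iff_ite]
  rintro ⟨M, hMN, hM, ξ, p, hp, hpm, hpb⟩ ⟨M', hMN', hM', ξ', p', hp', hpm', hpb'⟩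
  simp only [Label.state, bethe_eq, inner_smul_left, inner_smul_right]
  by_cases hMM : M = M'
  swap
  · rw [inner_slaterState_eq_zero hN hN0 hM hM' hMM, if_neg]
    · simp
    · intro h
      exact hMM (congrArg Label.M h)
  subst hMM
  rw [inner_slaterState hN hN0 hM]
  by_cases hξ : ξ = ξ'
  swap
  · rw [if_neg hξ, if_neg]
    · simp
    · intro h
      exact hξ (congrArg Label.ξ h)
  subst hξ
  have hG : (Matrix.of fun i j : Fin M => ∑ x : Fin N, star (amplitude Jx Jy (pos x) (p i)) *
      amplitude Jx Jy (pos x) (p' j)) =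
      Matrix.of fun i j => if p i = p' j then (N : ℂ) else 0 := by
    ext i j
    exact sum_star_amplitude_mul hN Jx Jy (hpm i) (hpm' j) (hpb i) (hpb' j)
  rw [hG]
  by_cases hpp : p = p'
  · subst hpp
    rw [if_pos rfl, if_pos rfl]
    have : (Matrix.of fun i j => if p i = p j then (N : ℂ) else 0) =
        Matrix.diagonal fun _ => (N : ℂ) := by
      ext i j
      simp [Matrix.diagonal_apply, hp.injective.eq_iff]
    rw [this, Matrix.det_diagonal, prod_const, card_univ, Fintype.card_fin]
    have h0 : 0 < 2 * (N : ℝ) ^ M := by positivity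
    have h1 : ((Real.sqrt (2 * (N : ℝ) ^ M) : ℝ) : ℂ) * (Real.sqrt (2 * (N : ℝ) ^ M) : ℝ) =
        2 * (N : ℂ) ^ M := by
      rw [← ofReal_mul, Real.mul_self_sqrt h0.le]
      push_cast
      rfl
    have h2 : (2 * (N : ℂ) ^ M) ≠ 0 := by exact_mod_cast h0.ne'
    rw [map_div₀, map_one, conj_ofReal, ← mul_assoc, div_mul_div_comm, h1, one_mul]
    exact one_div_mul_cancel h2
  · have hdet : (Matrix.of fun i j => if p i = p' j then (N : ℂ) else 0).det = 0 := by
      -- Otherwise the two increasing tuples would have the same range and coincide; the momentum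
      -- missing from p' yields a zero row.
      have : ∃ i, ∀ j, p i ≠ p' j := by
        by_contra hcon
        push Not at hcon
        apply hpp
        choose e he using hcon
        have hinj : Function.Injective e := by
          intro i j h
          apply hp.injective
          rw [he, he, h]
        refine (StrictMono.range_inj hp hp').1 (Set.Subset.antisymm ?_ ?_)
        · rintro _ ⟨i, rfl⟩
          exact ⟨e i, (he i).symm⟩
        · rintro _ ⟨j, rfl⟩
          obtain ⟨i, rfl⟩ := (Finite.injective_iff_surjective.1 hinj) j
          exact ⟨i, he i⟩
      obtain ⟨i, hi⟩ := this
      refine Matrix.det_eq_zero_of_row_eq_zero i fun j => ?_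
      simp [hi j]
    rw [hdet, if_pos rfl, if_neg]
    · simp
    · intro h
      injection h with h1 h2 h3
      exact hpp (by simpa using h3)

/-! ### Completeness by counting -/

lemma card_finset_parity (hN0 : 0 < N) (m : ℕ) :
    Fintype.card {S : Finset (Fin N) // S.card ≡ m [MOD 2]} * 2 = 2 ^ N := by
  have h1 : ∑ S : Finset (Fin N), (-1 : ℤ) ^ S.card = 0 := by
    rw [← Finset.powerset_univ]
    exact sum_powerset_neg_one_pow_card_of_nonempty ⟨⟨0, hN0⟩, mem_univ _⟩
  have h2 : ∀ S : Finset (Fin N), (1 + (-1 : ℤ) ^ m * (-1) ^ S.card) =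
      2 * if S.card ≡ m [MOD 2] then 1 else 0 := by
    intro S
    rw [neg_one_pow_eq_pow_mod_two (n := m), neg_one_pow_eq_pow_mod_two (n := S.card)]
    unfold Nat.ModEq
    rcases Nat.mod_two_eq_zero_or_one m with h | h <;>
      rcases Nat.mod_two_eq_zero_or_one S.card with h' | h' <;> simp [h, h']
  have h3 : ∑ S : Finset (Fin N), (1 + (-1 : ℤ) ^ m * (-1) ^ S.card) = 2 ^ N := by
    rw [sum_add_distrib, ← mul_sum, h1]
    simp
  simp only [h2, ← mul_sum, ← natCast_card_filter] at h3
  rw [Fintype.card_subtype, mul_comm]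
  exact_mod_cast h3

/-- The solutions of `e^{iNp} = (-1)^{ξ+1}` in the Brillouin zone. -/
def quasiMomentum (N ξ : ℕ) (k : Fin N) : ℝ :=
  -(Real.pi / 2) + 2 * Real.pi / N * ((k : ℕ) + if Even (N / 2 + ξ + 1) then 1 else 1 / 2)

lemma quasiMomentum_strictMono (N ξ : ℕ) : StrictMono (quasiMomentum N ξ) := by
  intro k l hkl
  have hN0 : (0 : ℝ) < N := by exact_mod_cast k.pos
  have : ((k : ℕ) : ℝ) < (l : ℕ) := by exact_mod_cast hkl
  have hpi := Real.pi_pos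
  unfold quasiMomentum
  gcongr

lemma quasiMomentum_mem (N ξ : ℕ) (k : Fin N) :
    quasiMomentum N ξ k ∈ Set.Ioc (-(Real.pi / 2)) (3 * Real.pi / 2) := by
  have hN0 : (0 : ℝ) < N := by exact_mod_cast k.pos
  have hpi := Real.pi_pos
  have hk : ((k : ℕ) : ℝ) + 1 ≤ N := by exact_mod_cast k.2
  unfold quasiMomentum
  constructor
  · have : 0 < 2 * Real.pi / N * (((k : ℕ) : ℝ) + if Even (N / 2 + ξ + 1) then 1 else 1 / 2) := by
      split_ifs <;> positivity
    linarith
  · have h1 : (((k : ℕ) : ℝ) + if Even (N / 2 + ξ + 1) then 1 else 1 / 2) ≤ N := by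
      split_ifs <;> linarith
    have h2 : 2 * Real.pi / N * (((k : ℕ) : ℝ) + if Even (N / 2 + ξ + 1) then 1 else 1 / 2) ≤
        2 * Real.pi / N * N := by gcongr
    have h3 : 2 * Real.pi / N * N = 2 * Real.pi := by field_simp
    linarith

/-- At the left end of the zone e^{iNp} is (-1)^{N/2}, so the grid of spacing 2π/N is offset by a
whole or a half step according to parity. The whole step replaces 0 because that end is excluded. -/
lemma exp_quasiMomentum (hN : Even N) (ξ : ℕ) (k : Fin N) :
    exp (I * N * quasiMomentum N ξ k) = (-1) ^ (ξ + 1) := by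
  have hN0 : (N : ℂ) ≠ 0 := by exact_mod_cast k.pos.ne'
  obtain ⟨K, hK⟩ := hN
  have hK2 : N / 2 = K := by omega
  set c : ℂ := if Even (N / 2 + ξ + 1) then 1 else 1 / 2 with hc
  have h1 : I * N * quasiMomentum N ξ k =
      (K : ℕ) * (-(Real.pi * I)) + ((k : ℕ) * (2 * Real.pi * I) + 2 * c * (Real.pi * I)) := by
    have h2 : ((quasiMomentum N ξ k : ℝ) : ℂ) =
        -(Real.pi / 2) + 2 * Real.pi / N * ((k : ℕ) + c) := by
      rw [quasiMomentum, hc]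
      split_ifs <;> push_cast <;> rfl
    have h3 : (N : ℂ) = K + K := by exact_mod_cast congrArg (Nat.cast : ℕ → ℂ) hK
    rw [h2]
    field_simp
    rw [h3]
    ring
  rw [h1, Complex.exp_add, Complex.exp_add, Complex.exp_nat_mul, Complex.exp_nat_mul,
    Complex.exp_neg, exp_pi_mul_I, exp_two_pi_mul_I, one_pow, one_mul]
  have h4 : ((-1 : ℂ))⁻¹ = -1 := by norm_num
  rw [h4, hc, hK2]
  split_ifs with h
  · rw [mul_one, ← mul_assoc, exp_two_pi_mul_I, mul_one, neg_one_pow_eq_pow_mod_two,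
      neg_one_pow_eq_pow_mod_two (n := ξ + 1)]
    congr 1
    grind
  · rw [show (2 : ℂ) * (1 / 2) * (Real.pi * I) = Real.pi * I by ring, exp_pi_mul_I, ← pow_succ,
      neg_one_pow_eq_pow_mod_two, neg_one_pow_eq_pow_mod_two (n := ξ + 1)]
    congr 1
    grind

/-- The label that occupies a set of quasi-momenta. -/
def labelOf (hN : Even N) (x : {S : Finset (Fin N) // S.card ≡ N / 2 [MOD 2]} × Fin 2) :
    Label N where
  M := x.1.1.card
  M_le := by simpa using card_le_univ x.1.1
  parity := x.1.2
  ξ := x.2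
  p := quasiMomentum N x.2 ∘ x.1.1.orderEmbOfFin rfl
  p_strictMono := (quasiMomentum_strictMono N x.2).comp (OrderEmbedding.strictMono _)
  p_mem _ := quasiMomentum_mem N x.2 _
  p_bethe _ := exp_quasiMomentum hN x.2 _

lemma labelOf_injective (hN : Even N) : Function.Injective (labelOf hN) := by
  rintro ⟨⟨S, hS⟩, ξ⟩ ⟨⟨T, hT⟩, ξ'⟩ h
  have h1 : ξ = ξ' := congrArg Label.ξ h
  subst h1
  have h2 : Set.range (labelOf hN ⟨⟨S, hS⟩, ξ⟩).p = Set.range (labelOf hN ⟨⟨T, hT⟩, ξ⟩).p := by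
    rw [h]
  simp only [labelOf, Set.range_comp, range_orderEmbOfFin] at h2
  have h3 := (quasiMomentum_strictMono N ξ).injective.image_injective h2
  have h4 : S = T := by exact_mod_cast h3
  subst h4
  rfl

/-- The labels built from sets of grid momenta already number 2^N, the dimension, so it is not
necessary to show that every label arises in this way. -/
lemma span_state (hN : Even N) (hN0 : 0 < N) (Jx Jy : ℝ) :
    Submodule.span ℂ (Set.range fun a : Label N => a.state Jx Jy) = ⊤ := by
  have hli := ((orthonormal_state hN hN0 Jx Jy).linearIndependent).comp _ (labelOf_injective hN)
  have hcard : Fintype.card ({S : Finset (Fin N) // S.card ≡ N / 2 [MOD 2]} × Fin 2) =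
      Module.finrank ℂ (StateSpace N) := by
    rw [Fintype.card_prod, Fintype.card_fin, card_finset_parity hN0, finrank_euclideanSpace]
    simp
  rw [eq_top_iff, ← hli.span_eq_top_of_card_eq_finrank' hcard]
  exact Submodule.span_mono (Set.range_comp_subset_range _ _)

end ChiralXY

end

theorem corollary4 (N : ℕ) (hN : Even N) (hN0 : 0 < N)
    (τ : ℂ) (hτ : 0 < τ.im) (Jx Jy : ℝ) (hJx : 0 < Jx) (hJy : 0 < Jy)
    (hx : (Jx : ℂ) = ChiralXY.theta3 τ / ChiralXY.theta4 τ)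
    (hy : (Jy : ℂ) = ChiralXY.theta4 τ / ChiralXY.theta3 τ) :
    Orthonormal ℂ (fun a : ChiralXY.Label N => a.state Jx Jy) ∧
    Submodule.span ℂ (Set.range fun a : ChiralXY.Label N => a.state Jx Jy) = ⊤ ∧
    ∀ a : ChiralXY.Label N,
      ChiralXY.hamiltonian N Jx Jy (a.state Jx Jy) =
        ((a.energy Jx Jy : ℝ) : ℂ) • a.state Jx Jy := by
  have hJ : Jx * Jy = 1 := by
    have h0 : (Jx : ℂ) ≠ 0 := by exact_mod_cast hJx.ne'
    have h1 : (Jy : ℂ) = (Jx : ℂ)⁻¹ := by rw [hx, hy, inv_div]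
    have h2 : (Jx : ℂ) * Jy = 1 := by rw [h1, mul_inv_cancel₀ h0]
    exact_mod_cast h2
  exact ⟨ChiralXY.orthonormal_state hN hN0 Jx Jy, ChiralXY.span_state hN hN0 Jx Jy,
    fun a => ChiralXY.hamiltonian_bethe hN hJx hJy hJ a⟩
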